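/- There is an absolute constant $C$ such that the following holds for every $\Delta\ge 0$, for the problems online Facility Location and online Steiner Tree. **Arrival model.** Let $V$ be the set of demand points, $\Omega_1,\dots,\Omega_n\subseteq V$ and $\Omega=\Omega_1\times\dots\times\Omega_n$. A distribution $\mathcal D$ on $\Omega$ is a $\Delta$-MRF distribution if there are a set $\mathcal E\subseteq 2^{[n]}$ of hyperedges and potentials $\psi_i:\Omega_i\to\mathbb R$ $(i\in[n])$ and $\psi_e:\prod_{i\in e}\Omega_i\to\mathbb R$ $(e\in\mathcal E)$ with $$\Pr_{v\sim\mathcal D}[v=u]\;\propto\;\exp\Big(\sum_{i\in[n]}\psi_i(u_i)+\sum_{e\in \mathcal E}\psi_e\big((u_i)_{i\in e}\big)\Big)\quad(u\in\Omega),\qquad \sup_{i\in[n]}\sup_{u\in\Omega}\Big|\sum_{e\in \mathcal E,\,e\ni i}\psi_e\big((u_j)_{j\in e}\big)\Big|=\Delta .$$ The distribution $\mathcal D$ is known to the algorithm; $(v_1,\dots,v_n)\sim\mathcal D$ is drawn and $v_1,\dots,v_n$ are revealed one by one. **Problems.** * *Facility Location*: $V=M$ is a (pseudo)metric space with opening costs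 $c(f)\ge 0$ for $f\in M$. The elements are the facilities $f\in M$, of cost $c(f)$, and the connections $(f,v)\in M\times M$, of cost $d_M(f,v)$. A set of elements is feasible for a set $D$ of clients if each $v\in D$ has a facility $f$ such that both $f$ and $(f,v)$ are selected. * *Steiner Tree*: $V$ is the vertex set of a graph with a root $r$ and edge costs $c(e)\ge 0$. The elements are the edges. A set $F$ of edges is feasible for a set $D\subseteq V$ if each $v\in D$ is connected to $r$ in $(V,F)$. The cost of a set of elements is the sum of their costs, and $\mathrm{OPT}(D)$ is the infimum of the costs of the sets that are feasible for $D$. It is assumed that for every single demand point $v\in\bigcup_i\Omega_i$ there is a feasible set for $\{v\}$ of cost exactly $\mathrm{OPT}(\{v\})$ (this is automatic in finite metric spaces, for uniform opening costs, and in finite graphs in which all these $v$ are connected to the root). **Claim.** For every such instance and every $\Delta$-MRF distribution $\mathcal D$ of the demands there is a (randomized) online algorithm that after each arrival $v_i$ irrevocably adds elements to its selection $F_{i-1}$ (where $F_0=\varnothing$), depending only on $v_1,\dots,v_i$ and its own randomness, such that the selection $F_i$ obtained is always feasible for $\{v_1,\dots,v_i\}$, and $$\mathbb E[\text{cost of }F_n]\;\le\;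 C\,(1+\Delta)\cdot\mathbb E_{v\sim\mathcal D}\big[\mathrm{OPT}(\{v_1,\dots,v_n\})\big].$$ That is, both problems admit $O(\Delta)$-competitive algorithms in the $\Delta$-MRF arrival model. -/

import Mathlib

open scoped ENNReal NNReal

universe u

noncomputable section

/-! ## Markov random fields -/

/-- A Markov random field on `Ω 0 × ⋯ × Ω (n - 1)`: a hypergraph on the coordinates, a potential on
each coordinate and a potential on each hyperedge. -/
structure MRF {n : ℕ} (Ω : Fin n → Type*) where
  /-- the hyperedges -/
  edges : Finset (Finset (Fin n))
  /-- `ψ_i : Ω_i → ℝ` -/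
  vertexPotential : (i : Fin n) → Ω i → ℝ
  /-- `ψ_e : ∏_{i ∈ e} Ω_i → ℝ`; only the values at `e ∈ edges` are used -/
  edgePotential : (e : Finset (Fin n)) → ((i : {i // i ∈ e}) → Ω i.1) → ℝ

namespace MRF

variable {n : ℕ} {Ω : Fin n → Type*}

/-- The unnormalised probability `exp (∑ i, ψ_i (u_i) + ∑ e, ψ_e (u_e))`. -/
def weight (M : MRF Ω) (u : (i : Fin n) → Ω i) : ℝ≥0∞ :=
  ENNReal.ofReal (Real.exp (∑ i, M.vertexPotential i (u i)
    + ∑ e ∈ M.edges, M.edgePotential e (fun i => u i.1)))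

/-- `D` is the distribution defined by `M`: `D u` is proportional to `M.weight u`. (As `D` has total
mass `1`, the normalising sum is then finite.) -/
def Generates (M : MRF Ω) (D : PMF ((i : Fin n) → Ω i)) : Prop :=
  ∀ u, D u = M.weight u / ∑' v, M.weight v

/-- The weighted maximum degree `max_i max_u |∑_{e ∋ i} ψ_e (u_e)|`, possibly infinite. -/
def weightedDegree (M : MRF Ω) : ℝ≥0∞ :=
  ⨆ (i : Fin n) (u : (i : Fin n) → Ω i),
    ENNReal.ofReal |∑ e ∈ M.edges with i ∈ e, M.edgePotential e (fun j => u j.1)|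

end MRF

/-- `D` is a `Δ`-MRF distribution. -/
def IsMRFDistribution {n : ℕ} {Ω : Fin n → Type*} (D : PMF ((i : Fin n) → Ω i)) (Δ : ℝ≥0) : Prop :=
  ∃ M : MRF Ω, M.Generates D ∧ M.weightedDegree = Δ

/-! ## Subadditive coverage problems -/

/-- A subadditive coverage problem with demand points `V` and elements `E`. Infinite sets of elements
are allowed as solutions, and may have infinite cost. -/
structure CoverageProblem (V E : Type*) where
  /-- the feasible solutions of a set of demands -/
  feasible : Set V → Set (Set E)
  union_mem_feasible : ∀ {D₁ D₂ : Set V} {S₁ S₂ : Set E},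
    S₁ ∈ feasible D₁ → S₂ ∈ feasible D₂ → S₁ ∪ S₂ ∈ feasible (D₁ ∪ D₂)
  feasible_anti : ∀ {D₁ D₂ : Set V}, D₁ ⊆ D₂ → feasible D₂ ⊆ feasible D₁
  /-- the cost of a set of elements -/
  cost : Set E → ℝ≥0∞
  cost_ne_top : ∀ {S : Set E}, S.Finite → cost S ≠ ∞
  cost_mono : ∀ {S₁ S₂ : Set E}, S₁ ⊆ S₂ → cost S₁ ≤ cost S₂
  cost_union_le : ∀ S₁ S₂ : Set E, cost (S₁ ∪ S₂) ≤ cost S₁ + cost S₂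

namespace CoverageProblem

variable {V E : Type*}

/-- The offline optimum of a set of demands. -/
def opt (P : CoverageProblem V E) (D : Set V) : ℝ≥0∞ :=
  ⨅ S ∈ P.feasible D, P.cost S

/-- The set of demands `D` has a feasible solution, and one of minimum cost. -/
def HasOptimalSolution (P : CoverageProblem V E) (D : Set V) : Prop :=
  ∃ S ∈ P.feasible D, P.cost S = P.opt D

end CoverageProblem

/-! ## Online algorithms -/

/-- A deterministic online algorithm maps the list `[v₁, …, v_i]` of the demands that have arrived
so far to the set `S_i` of the elements that it selects on the arrival of `v_i`. -/
abbrev OnlineAlgorithm (V E : Type*) := List V → Set E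

/-- A randomized online algorithm: a probability distribution over deterministic ones. -/
abbrev RandomizedOnlineAlgorithm (V E : Type*) := PMF (OnlineAlgorithm V E)

section Online

variable {V E : Type*} {n : ℕ}

/-- `F_k = S_1 ∪ ⋯ ∪ S_k`, all elements selected by the first `k` arrivals of `v`; `F_0 = ∅`. -/
def OnlineAlgorithm.selected (A : OnlineAlgorithm V E) (v : Fin n → V) (k : ℕ) : Set E :=
  ⋃ j ∈ Set.Icc 1 k, A ((List.ofFn v).take j)

/-- After each arrival, the elements selected so far are feasible for the demands so far. -/
def OnlineAlgorithm.IsFeasible (A : OnlineAlgorithm V E) (P : CoverageProblem V E)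
    (v : Fin n → V) : Prop :=
  ∀ k ∈ Set.Icc 1 n, A.selected v k ∈ P.feasible {x | x ∈ (List.ofFn v).take k}

variable {Ω : Fin n → Set V}

/-- The expected final cost on demands drawn from `D`. -/
def RandomizedOnlineAlgorithm.expectedCost (R : RandomizedOnlineAlgorithm V E)
    (P : CoverageProblem V E) (D : PMF ((i : Fin n) → Ω i)) : ℝ≥0∞ :=
  ∑' A, R A * ∑' u, D u * P.cost (OnlineAlgorithm.selected A (fun i => (u i : V)) n)

/-- The expected offline optimum on demands drawn from `D`. -/
def CoverageProblem.expectedOpt (P : CoverageProblem V E) (D : PMF ((i : Fin n) → Ω i)) : ℝ≥0∞ :=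
  ∑' u, D u * P.opt (Set.range (fun i => (u i : V)))

/-- The randomized online algorithm always maintains a feasible solution, and its expected cost is
at most `ρ` times the expected offline optimum, on demands drawn from `D`. -/
def RandomizedOnlineAlgorithm.IsCompetitive (R : RandomizedOnlineAlgorithm V E)
    (P : CoverageProblem V E) (D : PMF ((i : Fin n) → Ω i)) (ρ : ℝ≥0) : Prop :=
  (∀ A ∈ R.support, ∀ u ∈ D.support, OnlineAlgorithm.IsFeasible A P (fun i => (u i : V))) ∧
    R.expectedCost P D ≤ ρ * P.expectedOpt D

end Online

/-! ## Additive costs, Facility Location and Steiner Tree -/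

/-- The sum of the costs `w e` of the elements `e` of `S`. -/
def additiveCost {E : Type*} (w : E → ℝ≥0) (S : Set E) : ℝ≥0∞ := ∑' e : S, (w e : ℝ≥0∞)

theorem additiveCost_ne_top {E : Type*} (w : E → ℝ≥0) {S : Set E} (hS : S.Finite) :
    additiveCost w S ≠ ∞ := by
  have := hS.fintype
  rw [additiveCost, tsum_fintype]
  exact ENNReal.sum_ne_top.2 fun _ _ => ENNReal.coe_ne_top

theorem additiveCost_mono {E : Type*} (w : E → ℝ≥0) {S₁ S₂ : Set E} (h : S₁ ⊆ S₂) :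
    additiveCost w S₁ ≤ additiveCost w S₂ :=
  ENNReal.tsum_mono_subtype (fun e => (w e : ℝ≥0∞)) h

theorem additiveCost_union_le {E : Type*} (w : E → ℝ≥0) (S₁ S₂ : Set E) :
    additiveCost w (S₁ ∪ S₂) ≤ additiveCost w S₁ + additiveCost w S₂ :=
  ENNReal.tsum_union_le (fun e => (w e : ℝ≥0∞)) S₁ S₂

/-- Facility Location: the element `Sum.inl f` opens a facility at `f` and costs `c f`, the element
`Sum.inr (f, v)` connects the client `v` to `f` and costs their distance. A solution is feasible if
each client is connected to an open facility. In a pseudometric space, distinct clients may share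
a location. -/
def facilityLocation (M : Type*) [PseudoMetricSpace M] (c : M → ℝ≥0) :
    CoverageProblem M (M ⊕ M × M) where
  feasible D := {S | ∀ v ∈ D, ∃ f, Sum.inl f ∈ S ∧ Sum.inr (f, v) ∈ S}
  union_mem_feasible h₁ h₂ v hv := by
    rcases hv with hv | hv
    · obtain ⟨f, hf, hfv⟩ := h₁ v hv
      exact ⟨f, Or.inl hf, Or.inl hfv⟩
    · obtain ⟨f, hf, hfv⟩ := h₂ v hv
      exact ⟨f, Or.inr hf, Or.inr hfv⟩
  feasible_anti h _ hS v hv := hS v (h hv)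
  cost := additiveCost (Sum.elim c fun p => nndist p.1 p.2)
  cost_ne_top := additiveCost_ne_top _
  cost_mono := additiveCost_mono _
  cost_union_le := additiveCost_union_le _

/-- Steiner Tree on the graph `G` with root `r` and edge costs `w`: a set of edges is feasible if
it connects each demand to the root. -/
def steinerTree {V : Type*} (G : SimpleGraph V) (r : V) (w : G.edgeSet → ℝ≥0) :
    CoverageProblem V G.edgeSet where
  feasible D := {F | ∀ v ∈ D, (SimpleGraph.fromEdgeSet (Subtype.val '' F)).Reachable r v}
  union_mem_feasible h₁ h₂ v hv := by
    rcases hv with hv | hv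
    · exact (h₁ v hv).mono
        (SimpleGraph.fromEdgeSet_mono (Set.image_mono Set.subset_union_left))
    · exact (h₂ v hv).mono
        (SimpleGraph.fromEdgeSet_mono (Set.image_mono Set.subset_union_right))
  feasible_anti h _ hF v hv := hF v (h hv)
  cost := additiveCost w
  cost_ne_top := additiveCost_ne_top _
  cost_mono := additiveCost_mono _
  cost_union_le := additiveCost_union_le _

end

/-! Since D is known, the algorithm draws an independent sample s from D, buys a near-optimal
solution for s on the first arrival, and serves the actual demands u greedily on top of it. Let S be
the points of s, and X the points of s and u together. By subadditivity OPT(X) ≤ OPT(s) + OPT(u), so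
bounds against OPT(X) suffice.

The random field enters through an exchange: swapping the i-th coordinates of s and u preserves X
and changes D(s)D(u) by a factor of at most e^{4Δ} (`IsMRFDistribution.mul_le`). Hence an amount
attached to the points of X \ S can be charged, at the loss of e^{4Δ}, to points of the sample
(`tsum_exchange_le`).

The greedy cost is controlled by a logarithmic potential on a near-optimal solution for X. For
Facility Location this is a clustering of X: the t-th client of a cluster pays its distance to the
centre plus O(1/t) of the cluster cost (`serviceCost_cons_le`), so a cluster of cost L pays O(L
log((1 + |X_a|)/(1 + |S_a|))) in total. For Steiner Tree it is a closed tour through X: a new point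
connects along the side on which the number of unserved points halves, so each edge of the tour is
paid O(log(1 + number of unserved points around it)) times (`exists_lineDist_le`).

Finally log(1 + y) ≤ log(1 + K) + y/(1 + K) with K of order e^{4Δ}. The first term gives O(1 + Δ)
OPT(X). The second is linear in the number of new points, so the exchange bounds its expectation by
O(e^{4Δ}/(1 + K)) = O(1) times that of OPT(X). Infima need not be attained; the resulting additive
error ε is absorbed by `exists_isCompetitive_of_approx`. -/

noncomputable section

/-! ## Exchanging a coordinate of two independent draws -/

section Exchange

variable {n : ℕ}

/-- The exponent of the weight of a Markov random field. -/
def MRF.exponent {Ω : Fin n → Type*} (M : MRF Ω) (u : (i : Fin n) → Ω i) : ℝ :=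
  ∑ i, M.vertexPotential i (u i) + ∑ e ∈ M.edges, M.edgePotential e (fun i => u i.1)

theorem MRF.weight_eq {Ω : Fin n → Type*} (M : MRF Ω) (u : (i : Fin n) → Ω i) :
    M.weight u = ENNReal.ofReal (Real.exp (M.exponent u)) := rfl

theorem MRF.abs_sum_edgePotential_le {Ω : Fin n → Type*} {M : MRF Ω} {Δ : ℝ≥0}
    (h : M.weightedDegree = Δ) (i : Fin n) (u : (i : Fin n) → Ω i) :
    |∑ e ∈ M.edges with i ∈ e, M.edgePotential e (fun j => u j.1)| ≤ Δ := by
  have : ENNReal.ofReal |∑ e ∈ M.edges with i ∈ e, M.edgePotential e (fun j => u j.1)| ≤ Δ := by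
    rw [← h, MRF.weightedDegree]
    exact le_iSup₂_of_le i u le_rfl
  rw [ENNReal.ofReal_le_iff_le_toReal ENNReal.coe_ne_top] at this
  exact this

/-- Exchanging the `i`-th coordinates of two configurations. -/
def exchangeCoord {Ω : Fin n → Type*} (i : Fin n)
    (x : ((i : Fin n) → Ω i) × ((i : Fin n) → Ω i)) :
    ((i : Fin n) → Ω i) × ((i : Fin n) → Ω i) :=
  (Function.update x.1 i (x.2 i), Function.update x.2 i (x.1 i))

theorem exchangeCoord_involutive {Ω : Fin n → Type*} (i : Fin n) :
    Function.Involutive (exchangeCoord (Ω := Ω) i) := by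
  rintro ⟨s, u⟩
  simp [exchangeCoord]

/-- The vertex potentials are merely swapped, and hyperedges avoiding `i` do not notice the
exchange. The four remaining sums, over the hyperedges through `i`, lie between -Δ and Δ. -/
theorem MRF.exponent_add_le {Ω : Fin n → Type*} {M : MRF Ω} {Δ : ℝ≥0}
    (h : M.weightedDegree = Δ) (i : Fin n) (s u : (i : Fin n) → Ω i) :
    M.exponent s + M.exponent u ≤ 4 * Δ + (M.exponent (Function.update s i (u i)) +
      M.exponent (Function.update u i (s i))) := by
  have hv : ∑ j, M.vertexPotential j (s j) + ∑ j, M.vertexPotential j (u j) =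
      ∑ j, M.vertexPotential j (Function.update s i (u i) j) +
        ∑ j, M.vertexPotential j (Function.update u i (s i) j) := by
    rw [← Finset.sum_add_distrib, ← Finset.sum_add_distrib]
    refine Finset.sum_congr rfl fun j _ => ?_
    rcases eq_or_ne j i with rfl | hj
    · simp [add_comm]
    · simp [hj]
  have he : ∀ (s : (i : Fin n) → Ω i) (a : Ω i),
      ∑ e ∈ M.edges with ¬ i ∈ e, M.edgePotential e (fun j => s j.1) =
      ∑ e ∈ M.edges with ¬ i ∈ e, M.edgePotential e (fun j => Function.update s i a j.1) := by
    intro s a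
    refine Finset.sum_congr rfl fun e he => ?_
    congr 1
    funext j
    rw [Function.update_of_ne]
    rintro rfl
    exact (Finset.mem_filter.1 he).2 j.2
  have split : ∀ s : (i : Fin n) → Ω i, M.exponent s = ∑ j, M.vertexPotential j (s j) +
      (∑ e ∈ M.edges with i ∈ e, M.edgePotential e (fun j => s j.1) +
        ∑ e ∈ M.edges with ¬ i ∈ e, M.edgePotential e (fun j => s j.1)) := by
    intro s
    rw [Finset.sum_filter_add_sum_filter_not]
    rfl
  rw [split s, split u, split (Function.update s i (u i)), split (Function.update u i (s i)),
    ← he s, ← he u]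
  have h1 := abs_le.1 (M.abs_sum_edgePotential_le h i s)
  have h2 := abs_le.1 (M.abs_sum_edgePotential_le h i u)
  have h3 := abs_le.1 (M.abs_sum_edgePotential_le h i (Function.update s i (u i)))
  have h4 := abs_le.1 (M.abs_sum_edgePotential_le h i (Function.update u i (s i)))
  linarith [h1.1, h1.2, h2.1, h2.2, h3.1, h3.2, h4.1, h4.2]

theorem IsMRFDistribution.mul_le {Ω : Fin n → Type*} {D : PMF ((i : Fin n) → Ω i)} {Δ : ℝ≥0}
    (h : IsMRFDistribution D Δ) (i : Fin n) (x : ((i : Fin n) → Ω i) × ((i : Fin n) → Ω i)) :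
    D x.1 * D x.2 ≤ ENNReal.ofReal (Real.exp (4 * Δ)) *
      (D (exchangeCoord i x).1 * D (exchangeCoord i x).2) := by
  obtain ⟨M, hM, hΔ⟩ := h
  have key : M.weight x.1 * M.weight x.2 ≤ ENNReal.ofReal (Real.exp (4 * Δ)) *
      (M.weight (exchangeCoord i x).1 * M.weight (exchangeCoord i x).2) := by
    simp only [MRF.weight_eq]
    rw [← ENNReal.ofReal_mul (Real.exp_nonneg _), ← ENNReal.ofReal_mul (Real.exp_nonneg _),
      ← ENNReal.ofReal_mul (Real.exp_nonneg _), ← Real.exp_add, ← Real.exp_add, ← Real.exp_add]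
    exact ENNReal.ofReal_le_ofReal (Real.exp_le_exp.2 (M.exponent_add_le hΔ i x.1 x.2))
  rw [hM, hM, hM, hM]
  simp only [div_eq_mul_inv]
  calc _ = M.weight x.1 * M.weight x.2 * ((∑' v, M.weight v)⁻¹ * (∑' v, M.weight v)⁻¹) := by ring
    _ ≤ _ := mul_le_mul_left key _
    _ = _ := by ring

/-- Weights are exponentials, so D has full support. This turns statements about the expected
optimum being zero or finite into statements about every configuration. -/
theorem IsMRFDistribution.ne_zero {Ω : Fin n → Type*} {D : PMF ((i : Fin n) → Ω i)} {Δ : ℝ≥0}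
    (h : IsMRFDistribution D Δ) (u : (i : Fin n) → Ω i) : D u ≠ 0 := by
  obtain ⟨M, hM, -⟩ := h
  have htop : ∑' v, M.weight v ≠ ∞ := by
    intro htop
    obtain ⟨v, hv⟩ := D.support_nonempty
    rw [PMF.mem_support_iff, hM, htop, ENNReal.div_top] at hv
    exact hv rfl
  rw [hM]
  refine ENNReal.div_ne_zero.2 ⟨?_, htop⟩
  rw [MRF.weight_eq]
  simpa using Real.exp_pos _

open Classical in
/-- The set of the demand points of a configuration. -/
def demandPoints {V : Type*} {Ω : Fin n → Set V} (u : (i : Fin n) → Ω i) : Finset V :=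
  Finset.univ.image fun i => (u i : V)

variable {V : Type*} {Ω : Fin n → Set V}

theorem mem_demandPoints {u : (i : Fin n) → Ω i} {p : V} :
    p ∈ demandPoints u ↔ ∃ i, (u i : V) = p := by
  simp [demandPoints]

theorem coe_demandPoints (u : (i : Fin n) → Ω i) :
    (demandPoints u : Set V) = Set.range fun i => (u i : V) := by
  simp [demandPoints]

open Classical in
/-- All demand points of a pair of configurations. -/
def jointDemandPoints (x : ((i : Fin n) → Ω i) × ((i : Fin n) → Ω i)) : Finset V :=
  demandPoints x.1 ∪ demandPoints x.2

theorem mem_jointDemandPoints {x : ((i : Fin n) → Ω i) × ((i : Fin n) → Ω i)} {p : V} :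
    p ∈ jointDemandPoints x ↔ ∃ i, (x.1 i : V) = p ∨ (x.2 i : V) = p := by
  simp [jointDemandPoints, mem_demandPoints, exists_or]

/-- Because of this invariance, a clustering or tour chosen as a function of the joint set stays
fixed under the exchange. -/
theorem jointDemandPoints_exchangeCoord (i : Fin n)
    (x : ((i : Fin n) → Ω i) × ((i : Fin n) → Ω i)) :
    jointDemandPoints (exchangeCoord i x) = jointDemandPoints x := by
  ext p
  rw [mem_jointDemandPoints, mem_jointDemandPoints]
  refine exists_congr fun j => ?_
  rcases eq_or_ne j i with rfl | hj
  · simp [exchangeCoord, or_comm]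
  · simp [exchangeCoord, hj]

open Classical in
theorem demandPoints_exchangeCoord_subset (i : Fin n)
    (x : ((i : Fin n) → Ω i) × ((i : Fin n) → Ω i)) :
    demandPoints (exchangeCoord i x).1 ⊆ insert (x.2 i : V) (demandPoints x.1) := by
  intro p hp
  obtain ⟨j, rfl⟩ := mem_demandPoints.1 hp
  rcases eq_or_ne j i with rfl | hj
  · simp [exchangeCoord]
  · simp [exchangeCoord, hj, mem_demandPoints]

theorem mem_demandPoints_exchangeCoord (i : Fin n)
    (x : ((i : Fin n) → Ω i) × ((i : Fin n) → Ω i)) :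
    (x.2 i : V) ∈ demandPoints (exchangeCoord i x).1 :=
  mem_demandPoints.2 ⟨i, by simp [exchangeCoord]⟩

open Classical in
/-- If exchanging a coordinate changes the probability of a pair of configurations by a factor of at
most `K`, then the points that occur only in the second configuration can be charged to points of
the first one. -/
theorem tsum_exchange_le (D : PMF ((i : Fin n) → Ω i)) {K : ℝ≥0∞}
    (hK : ∀ i x, D x.1 * D x.2 ≤ K * (D (exchangeCoord i x).1 * D (exchangeCoord i x).2))
    (φ ψ : ((i : Fin n) → Ω i) × ((i : Fin n) → Ω i) → V → ℝ≥0∞)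
    (h : ∀ x i, (x.2 i : V) ∉ demandPoints x.1 → φ x (x.2 i) ≤ ψ (exchangeCoord i x) (x.2 i)) :
    ∑' x : ((i : Fin n) → Ω i) × ((i : Fin n) → Ω i),
        D x.1 * D x.2 * ∑ p ∈ jointDemandPoints x \ demandPoints x.1, φ x p ≤
      K * ∑' x : ((i : Fin n) → Ω i) × ((i : Fin n) → Ω i),
        D x.1 * D x.2 * ∑ p ∈ demandPoints x.1, ψ x p := by
  -- `Q i x`: the point at coordinate `i` of the first configuration occurs there only once.
  -- Exchanging in a point that was absent always produces this situation, and it prevents counting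
  -- a point of the first configuration repeatedly.
  let Q : Fin n → ((i : Fin n) → Ω i) × ((i : Fin n) → Ω i) → Prop := fun i x =>
    ∀ j, j ≠ i → (x.1 j : V) ≠ x.1 i
  have h1 : ∀ x : ((i : Fin n) → Ω i) × ((i : Fin n) → Ω i),
      ∑ p ∈ jointDemandPoints x \ demandPoints x.1, φ x p ≤
        ∑ i, if (x.2 i : V) ∉ demandPoints x.1 then φ x (x.2 i) else 0 := by
    intro x
    rw [← Finset.sum_filter]
    have : jointDemandPoints x \ demandPoints x.1 ⊆
        ((Finset.univ.filter fun i => (x.2 i : V) ∉ demandPoints x.1).image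
          fun i => (x.2 i : V)) := by
      intro p hp
      rw [Finset.mem_sdiff, jointDemandPoints, Finset.mem_union] at hp
      obtain ⟨i, rfl⟩ := mem_demandPoints.1 (hp.1.resolve_left hp.2)
      exact Finset.mem_image.2 ⟨i, by simpa using hp.2, rfl⟩
    refine (Finset.sum_le_sum_of_subset this).trans ?_
    exact Finset.sum_image_le_of_nonneg (fun _ _ => zero_le)
  have h2 : ∀ x : ((i : Fin n) → Ω i) × ((i : Fin n) → Ω i),
      ∑ i, (if Q i x then ψ x (x.1 i) else 0) ≤ ∑ p ∈ demandPoints x.1, ψ x p := by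
    intro x
    rw [← Finset.sum_filter]
    rw [← Finset.sum_image (g := fun i => (x.1 i : V)) (f := fun p => ψ x p)]
    · refine Finset.sum_le_sum_of_subset ?_
      exact Finset.image_subset_image (Finset.filter_subset _ _)
    · intro i hi j hj hij
      by_contra hne
      exact (Finset.mem_filter.1 hj).2 i hne hij
  have h3 : ∀ i (x : ((i : Fin n) → Ω i) × ((i : Fin n) → Ω i)),
      D x.1 * D x.2 * (if (x.2 i : V) ∉ demandPoints x.1 then φ x (x.2 i) else 0) ≤
        K * ((fun y : ((i : Fin n) → Ω i) × ((i : Fin n) → Ω i) =>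
          D y.1 * D y.2 * if Q i y then ψ y (y.1 i) else 0) (exchangeCoord i x)) := by
    intro i x
    by_cases hx : (x.2 i : V) ∈ demandPoints x.1
    · simp [hx]
    · have hQ : Q i (exchangeCoord i x) := by
        intro j hj
        simp only [exchangeCoord, Function.update_self, ne_eq, hj, not_false_eq_true,
          Function.update_of_ne]
        intro he
        exact hx (mem_demandPoints.2 ⟨j, he⟩)
      have hi : ((exchangeCoord i x).1 i : V) = x.2 i := by simp [exchangeCoord]
      simp only [hQ, if_true, hi, hx, not_false_eq_true]
      calc _ ≤ K * (D (exchangeCoord i x).1 * D (exchangeCoord i x).2) *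
            ψ (exchangeCoord i x) (x.2 i) := mul_le_mul' (hK i x) (h x i hx)
        _ = _ := by ring
  calc _ ≤ ∑' x : ((i : Fin n) → Ω i) × ((i : Fin n) → Ω i), ∑ i, D x.1 * D x.2 *
        (if (x.2 i : V) ∉ demandPoints x.1 then φ x (x.2 i) else 0) := by
        refine ENNReal.tsum_le_tsum fun x => ?_
        rw [← Finset.mul_sum]
        exact mul_le_mul_right (h1 x) _
    _ = ∑ i, ∑' x : ((i : Fin n) → Ω i) × ((i : Fin n) → Ω i), D x.1 * D x.2 *
        (if (x.2 i : V) ∉ demandPoints x.1 then φ x (x.2 i) else 0) :=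
        Summable.tsum_finsetSum fun _ _ => ENNReal.summable
    _ ≤ ∑ i, ∑' x, K * ((fun y : ((i : Fin n) → Ω i) × ((i : Fin n) → Ω i) =>
          D y.1 * D y.2 * if Q i y then ψ y (y.1 i) else 0) (exchangeCoord i x)) :=
        Finset.sum_le_sum fun i _ => ENNReal.tsum_le_tsum fun x => h3 i x
    _ = ∑ i, K * ∑' x : ((i : Fin n) → Ω i) × ((i : Fin n) → Ω i),
          D x.1 * D x.2 * if Q i x then ψ x (x.1 i) else 0 := by
        refine Finset.sum_congr rfl fun i _ => ?_
        rw [ENNReal.tsum_mul_left]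
        congr 1
        exact (Equiv.tsum_eq (exchangeCoord_involutive (Ω := fun i => Ω i) i).toPerm
          fun y : ((i : Fin n) → Ω i) × ((i : Fin n) → Ω i) =>
            D y.1 * D y.2 * if Q i y then ψ y (y.1 i) else 0)
    _ = K * ∑' x : ((i : Fin n) → Ω i) × ((i : Fin n) → Ω i),
          ∑ i, D x.1 * D x.2 * if Q i x then ψ x (x.1 i) else 0 := by
        rw [← Finset.mul_sum, Summable.tsum_finsetSum fun _ _ => ENNReal.summable]
    _ ≤ _ := by
        refine mul_le_mul_right (ENNReal.tsum_le_tsum fun x => ?_) _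
        rw [← Finset.mul_sum]
        exact mul_le_mul_right (h2 x) _

end Exchange

/-! ## Online algorithms from increasing solutions -/

section Cumulative

variable {V E : Type*} {n : ℕ}

theorem subset_append_of_subset_cons {T : List V → Set E} (hT : ∀ x l, T l ⊆ T (x :: l))
    (l m : List V) : T m ⊆ T (l ++ m) := by
  induction l with
  | nil => exact subset_rfl
  | cons x l ih => exact ih.trans (hT x _)

theorem take_reverse_subset {T : List V → Set E} (hT : ∀ x l, T l ⊆ T (x :: l))
    (l : List V) {j k : ℕ} (hjk : j ≤ k) : T (l.take j).reverse ⊆ T (l.take k).reverse := by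
  have : l.take k = l.take j ++ (l.take k).drop j := by
    conv_lhs => rw [← List.take_append_drop j (l.take k)]
    rw [List.take_take, min_eq_left hjk]
  rw [this, List.reverse_append]
  exact subset_append_of_subset_cons hT _ _

theorem selected_reverse_subset {T : List V → Set E} (hT : ∀ x l, T l ⊆ T (x :: l))
    (v : Fin n → V) (k : ℕ) :
    OnlineAlgorithm.selected (fun l => T l.reverse) v k ⊆ T ((List.ofFn v).take k).reverse :=
  Set.iUnion₂_subset fun _ hj => take_reverse_subset hT _ hj.2

/-- `1 ≤ k` is needed: nothing is selected before the first arrival, while `T []`, the solution for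
the sample, may be nonempty. -/
theorem selected_reverse {T : List V → Set E} (hT : ∀ x l, T l ⊆ T (x :: l))
    (v : Fin n → V) {k : ℕ} (hk : 1 ≤ k) :
    OnlineAlgorithm.selected (fun l => T l.reverse) v k = T ((List.ofFn v).take k).reverse :=
  (selected_reverse_subset hT v k).antisymm
    (Set.subset_biUnion_of_mem (u := fun j => T ((List.ofFn v).take j).reverse)
      (show k ∈ Set.Icc 1 k from ⟨hk, le_rfl⟩))

theorem PMF.tsum_map_mul {α β : Type*} (p : PMF α) (f : α → β) (g : β → ℝ≥0∞) :
    ∑' b, p.map f b * g b = ∑' a, p a * g (f a) := by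
  classical
  simp_rw [PMF.map_apply, ← ENNReal.tsum_mul_right]
  rw [ENNReal.tsum_comm]
  refine tsum_congr fun a => ?_
  rw [tsum_eq_single (f a)]
  · simp
  · intro b hb
    simp [hb]

variable {Ω : Fin n → Set V} {P : CoverageProblem V E}

/-- Increasing solutions, depending on an independent draw of the demands, form a randomized online
algorithm. -/
theorem exists_isCompetitive_of_cumulative (D : PMF ((i : Fin n) → Ω i))
    (T : ((i : Fin n) → Ω i) → List V → Set E) (hT : ∀ s x l, T s l ⊆ T s (x :: l))
    (hfeas : ∀ s l, (∀ x ∈ l, ∃ i, x ∈ Ω i) → T s l ∈ P.feasible {x | x ∈ l}) {ρ : ℝ≥0}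
    (hcost : ∑' x : ((i : Fin n) → Ω i) × ((i : Fin n) → Ω i),
      D x.1 * D x.2 * P.cost (T x.1 (List.ofFn fun i => (x.2 i : V)).reverse) ≤
        ρ * P.expectedOpt D) :
    ∃ R : RandomizedOnlineAlgorithm V E, R.IsCompetitive P D ρ := by
  refine ⟨D.map fun s l => T s l.reverse, ?_, ?_⟩
  · intro A hA u _ k hk
    rw [PMF.support_map] at hA
    obtain ⟨s, -, rfl⟩ := hA
    rw [selected_reverse (hT s) _ hk.1]
    convert hfeas s ((List.ofFn fun i => (u i : V)).take k).reverse ?_ using 2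
    · ext x; simp
    · intro x hx
      obtain ⟨i, rfl⟩ := List.mem_ofFn.1 (List.mem_of_mem_take (List.mem_reverse.1 hx))
      exact ⟨i, (u i).2⟩
  · refine le_trans ?_ hcost
    rw [RandomizedOnlineAlgorithm.expectedCost, PMF.tsum_map_mul, ENNReal.tsum_prod']
    refine ENNReal.tsum_le_tsum fun s => ?_
    rw [← ENNReal.tsum_mul_left]
    refine ENNReal.tsum_le_tsum fun u => ?_
    rw [← mul_assoc]
    refine mul_le_mul_right (P.cost_mono ?_) _
    -- Only an inclusion is used, as for `n = 0` the selection is empty but `T s []` may not be.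
    refine (selected_reverse_subset (hT s) _ n).trans (le_of_eq ?_)
    rw [List.take_of_length_le (by simp)]

theorem CoverageProblem.opt_le_of_feasible (P : CoverageProblem V E) {A : Set V} {S : Set E}
    (h : S ∈ P.feasible A) : P.opt A ≤ P.cost S := iInf₂_le S h

theorem CoverageProblem.opt_mono (P : CoverageProblem V E) {A B : Set V} (h : A ⊆ B) :
    P.opt A ≤ P.opt B :=
  le_iInf₂ fun _ hS => P.opt_le_of_feasible (P.feasible_anti h hS)

theorem CoverageProblem.opt_union_le (P : CoverageProblem V E) (A B : Set V) :
    P.opt (A ∪ B) ≤ P.opt A + P.opt B := by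
  simp only [CoverageProblem.opt, ENNReal.iInf_add, ENNReal.add_iInf]
  refine le_iInf₂ fun S hS => le_iInf₂ fun T hT => ?_
  exact (P.opt_le_of_feasible (P.union_mem_feasible hT hS)).trans (P.cost_union_le _ _)

/-- Serving each demand by a solution of its own. -/
theorem exists_cumulative_of_single (hf : ∅ ∈ P.feasible ∅) (hc : P.cost ∅ = 0)
    (hopt : ∀ i, ∀ v ∈ Ω i, P.HasOptimalSolution {v}) :
    ∃ T : List V → Set E, (∀ x l, T l ⊆ T (x :: l)) ∧
      (∀ l, (∀ x ∈ l, ∃ i, x ∈ Ω i) → T l ∈ P.feasible {x | x ∈ l}) ∧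
      ∀ l, (∀ x ∈ l, ∃ i, x ∈ Ω i) → (∀ x ∈ l, P.opt {x} = 0) → P.cost (T l) = 0 := by
  classical
  have : ∀ v : V, ∃ S : Set E, (∃ i, v ∈ Ω i) → S ∈ P.feasible {v} ∧ P.cost S = P.opt {v} := by
    intro v
    by_cases hv : ∃ i, v ∈ Ω i
    · obtain ⟨i, hi⟩ := hv
      obtain ⟨S, hS⟩ := hopt i v hi
      exact ⟨S, fun _ => hS⟩
    · exact ⟨∅, fun h => absurd h hv⟩
  choose S hS using this
  refine ⟨fun l => l.foldr (fun x B => S x ∪ B) ∅, fun x l => Set.subset_union_right, ?_, ?_⟩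
  · intro l hl
    induction l with
    | nil => simpa using hf
    | cons x l ih =>
      have := P.union_mem_feasible (hS x (hl x (by simp))).1
        (ih fun y hy => hl y (List.mem_cons_of_mem _ hy))
      have he : {y | y ∈ x :: l} = {x} ∪ {y | y ∈ l} := by ext y; simp
      rw [he]
      exact this
  · intro l hl h0
    induction l with
    | nil => exact hc
    | cons x l ih =>
      have h1 := ih (fun y hy => hl y (List.mem_cons_of_mem _ hy))
        (fun y hy => h0 y (List.mem_cons_of_mem _ hy))
      refine le_antisymm ((P.cost_union_le _ _).trans ?_) zero_le
      rw [h1, (hS x (hl x (by simp))).2, h0 x (by simp), add_zero]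

theorem CoverageProblem.tsum_opt_jointDemandPoints_le (D : PMF ((i : Fin n) → Ω i)) :
    ∑' x : ((i : Fin n) → Ω i) × ((i : Fin n) → Ω i),
      D x.1 * D x.2 * P.opt (jointDemandPoints x) ≤ 2 * P.expectedOpt D := by
  classical
  have h1 : ∑' x : ((i : Fin n) → Ω i) × ((i : Fin n) → Ω i),
      D x.1 * D x.2 * P.opt (demandPoints x.1) = P.expectedOpt D := by
    rw [ENNReal.tsum_prod']
    simp_rw [mul_right_comm _ (D _), ENNReal.tsum_mul_left, D.tsum_coe, mul_one, coe_demandPoints]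
    rfl
  have h2 : ∑' x : ((i : Fin n) → Ω i) × ((i : Fin n) → Ω i),
      D x.1 * D x.2 * P.opt (demandPoints x.2) = P.expectedOpt D := by
    rw [ENNReal.tsum_prod']
    simp_rw [mul_assoc, ENNReal.tsum_mul_left, ENNReal.tsum_mul_right, D.tsum_coe, one_mul,
      coe_demandPoints]
    rfl
  calc _ ≤ ∑' x : ((i : Fin n) → Ω i) × ((i : Fin n) → Ω i),
      (D x.1 * D x.2 * P.opt (demandPoints x.1) + D x.1 * D x.2 * P.opt (demandPoints x.2)) := by
        refine ENNReal.tsum_le_tsum fun x => ?_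
        rw [← mul_add]
        refine mul_le_mul_right ?_ _
        rw [jointDemandPoints, Finset.coe_union]
        exact P.opt_union_le _ _
    _ = _ := by rw [ENNReal.tsum_add, h1, h2, two_mul]

theorem PMF.tsum_prod_mul_const (D : PMF ((i : Fin n) → Ω i)) (c : ℝ≥0∞) :
    ∑' x : ((i : Fin n) → Ω i) × ((i : Fin n) → Ω i), D x.1 * D x.2 * c = c := by
  rw [ENNReal.tsum_mul_right, ENNReal.tsum_prod']
  simp_rw [ENNReal.tsum_mul_left, D.tsum_coe, mul_one, D.tsum_coe, one_mul]

/-- As the expected optimum is known, an arbitrarily small additive error can be allowed. -/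
theorem exists_isCompetitive_of_approx (hf : ∅ ∈ P.feasible ∅) (hc : P.cost ∅ = 0)
    (D : PMF ((i : Fin n) → Ω i)) (hD : ∀ u, D u ≠ 0)
    (hopt : ∀ i, ∀ v ∈ Ω i, P.HasOptimalSolution {v}) {ρ : ℝ≥0} (hρ : 0 < ρ)
    (h : n ≠ 0 → (∀ u : (i : Fin n) → Ω i, P.opt (demandPoints u) ≠ ∞) → ∀ ε : ℝ, 0 < ε →
      ∃ T : ((i : Fin n) → Ω i) → List V → Set E, (∀ s x l, T s l ⊆ T s (x :: l)) ∧
        (∀ s l, (∀ x ∈ l, ∃ i, x ∈ Ω i) → T s l ∈ P.feasible {x | x ∈ l}) ∧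
        ∑' x : ((i : Fin n) → Ω i) × ((i : Fin n) → Ω i),
          D x.1 * D x.2 * P.cost (T x.1 (List.ofFn fun i => (x.2 i : V)).reverse) ≤
            ρ * (P.expectedOpt D + ENNReal.ofReal ε)) :
    ∃ R : RandomizedOnlineAlgorithm V E, R.IsCompetitive P D (2 * ρ) := by
  obtain ⟨T₀, hT₀, hT₀f, hT₀c⟩ := exists_cumulative_of_single hf hc hopt
  have hρ' : ((2 * ρ : ℝ≥0) : ℝ≥0∞) ≠ 0 := by
    simpa using hρ.ne'
  by_cases htop : P.expectedOpt D = ∞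
  · refine exists_isCompetitive_of_cumulative D (fun _ => T₀) (fun _ => hT₀) (fun _ => hT₀f) ?_
    rw [htop, ENNReal.mul_top hρ']
    exact le_top
  -- A vanishing optimum leaves no room for an error. By full support every single demand then has
  -- optimum zero, and it is attained, so serving each demand separately is free.
  by_cases hzero : n = 0 ∨ P.expectedOpt D = 0
  · refine exists_isCompetitive_of_cumulative D (fun _ => T₀) (fun _ => hT₀) (fun _ => hT₀f) ?_
    refine le_trans (le_of_eq ?_) zero_le
    refine ENNReal.tsum_eq_zero.2 fun x => ?_
    rw [hT₀c, mul_zero]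
    · intro y hy
      obtain ⟨i, rfl⟩ := List.mem_ofFn.1 (List.mem_reverse.1 hy)
      exact ⟨i, (x.2 i).2⟩
    · intro y hy
      obtain ⟨i, rfl⟩ := List.mem_ofFn.1 (List.mem_reverse.1 hy)
      rcases hzero with rfl | hzero
      · exact i.elim0
      · have := (mul_eq_zero.1 (ENNReal.tsum_eq_zero.1 hzero x.2)).resolve_left (hD _)
        refine le_antisymm (le_trans (P.opt_mono ?_) this.le) zero_le
        simp
  · push Not at hzero
    have hpos : 0 < (P.expectedOpt D).toReal := ENNReal.toReal_pos hzero.2 htop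
    -- The error ε is chosen equal to the expected optimum, which doubles `ρ`.
    obtain ⟨T, hT, hTf, hTc⟩ := h hzero.1 (fun u hu => htop (by
      refine ENNReal.tsum_eq_top_of_eq_top ⟨u, ?_⟩
      rw [← coe_demandPoints, hu, ENNReal.mul_top (hD u)])) _ hpos
    refine exists_isCompetitive_of_cumulative D T hT hTf (hTc.trans (le_of_eq ?_))
    rw [ENNReal.ofReal_toReal htop]
    push_cast
    ring

end Cumulative

theorem additiveCost_empty {E : Type*} (w : E → ℝ≥0) : additiveCost w ∅ = 0 := by
  simp [additiveCost]

theorem additiveCost_coe_finset {E : Type*} (w : E → ℝ≥0) (S : Finset E) :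
    additiveCost w S = ∑ e ∈ S, (w e : ℝ≥0∞) := by
  rw [additiveCost]
  exact Finset.tsum_subtype' S fun e => (w e : ℝ≥0∞)

/-! ## Facility Location -/

section FacilityLocation

open scoped Classical

variable {M : Type*} [PseudoMetricSpace M] (c : M → ℝ≥0)

/-- The cost of opening the facilities `F` and connecting each client of `A` to the nearest one. -/
def serviceCost (A F : Finset M) : ℝ :=
  ∑ f ∈ F, (c f : ℝ) + ∑ j ∈ A, Metric.infDist j F

theorem serviceCost_nonneg (A F : Finset M) : 0 ≤ serviceCost c A F :=
  add_nonneg (Finset.sum_nonneg fun _ _ => NNReal.coe_nonneg _)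
    (Finset.sum_nonneg fun _ _ => Metric.infDist_nonneg)

/-- The infimum over finite supersets need not be attained, hence the slack `δ`. The empty set is
excluded because `Metric.infDist` to it is 0. -/
theorem exists_serviceCost_le [Nonempty M] {δ : ℝ} (hδ : 0 < δ) (A F : Finset M) :
    ∃ F' : Finset M, F ⊆ F' ∧ F'.Nonempty ∧
      ∀ G : Finset M, F ⊆ G → G.Nonempty → serviceCost c A F' ≤ serviceCost c A G + δ := by
  let s : Set ℝ := (serviceCost c A) '' {G : Finset M | F ⊆ G ∧ G.Nonempty}
  have hs : s.Nonempty :=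
    ⟨_, _, ⟨Finset.subset_insert (Classical.arbitrary M) F, Finset.insert_nonempty _ _⟩, rfl⟩
  have hb : BddBelow s := ⟨0, by rintro _ ⟨G, -, rfl⟩; exact serviceCost_nonneg c A G⟩
  obtain ⟨_, ⟨F', hF', rfl⟩, h⟩ := Real.lt_sInf_add_pos hs hδ
  refine ⟨F', hF'.1, hF'.2, fun G hG hG' => h.le.trans ?_⟩
  gcongr
  exact csInf_le hb ⟨G, ⟨hG, hG'⟩, rfl⟩

/-- Further facilities that are opened to serve `A` almost optimally. -/
def extendFacilities [Nonempty M] (δ : ℝ) (A F : Finset M) : Finset M :=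
  if hδ : 0 < δ then (exists_serviceCost_le c hδ A F).choose else F

/-- The facilities that are open after the clients `S` and the arrivals `l`, last arrival first. -/
def facilities [Nonempty M] (δ : ℝ) (S : Finset M) : List M → Finset M
  | [] => extendFacilities c δ S ∅
  | x :: l => extendFacilities c δ (S ∪ (x :: l).toFinset) (facilities δ S l)

section

variable [Nonempty M] {δ : ℝ} (hδ : 0 < δ)
include hδ

theorem subset_extendFacilities (A F : Finset M) : F ⊆ extendFacilities c δ A F := by
  rw [extendFacilities, dif_pos hδ]
  exact (exists_serviceCost_le c hδ A F).choose_spec.1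

theorem extendFacilities_nonempty (A F : Finset M) : (extendFacilities c δ A F).Nonempty := by
  rw [extendFacilities, dif_pos hδ]
  exact (exists_serviceCost_le c hδ A F).choose_spec.2.1

theorem serviceCost_extendFacilities_le (A : Finset M) {F G : Finset M} (hG : F ⊆ G)
    (hG' : G.Nonempty) :
    serviceCost c A (extendFacilities c δ A F) ≤ serviceCost c A G + δ := by
  rw [extendFacilities, dif_pos hδ]
  exact (exists_serviceCost_le c hδ A F).choose_spec.2.2 G hG hG'

theorem facilities_nonempty (S : Finset M) (l : List M) : (facilities c δ S l).Nonempty := by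
  cases l <;> exact extendFacilities_nonempty c hδ _ _

theorem facilities_subset_cons (S : Finset M) (x : M) (l : List M) :
    facilities c δ S l ⊆ facilities c δ S (x :: l) :=
  subset_extendFacilities c hδ _ _

/-- Each step optimises over all supersets of the previous facilities, so afterwards no further
openings can save more than `δ`. -/
theorem serviceCost_facilities_le (S : Finset M) (l : List M) {G : Finset M}
    (hG : facilities c δ S l ⊆ G) :
    serviceCost c (S ∪ l.toFinset) (facilities c δ S l) ≤
      serviceCost c (S ∪ l.toFinset) G + δ := by
  have hG' : G.Nonempty := (facilities_nonempty c hδ S l).mono hG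
  cases l with
  | nil =>
    simpa [facilities] using serviceCost_extendFacilities_le c hδ S (Finset.empty_subset G) hG'
  | cons x l =>
    exact serviceCost_extendFacilities_le c hδ _ ((facilities_subset_cons c hδ S x l).trans hG) hG'

end

theorem infDist_le_infDist_finset {F G : Finset M} (h : F ⊆ G) (hF : F.Nonempty) (j : M) :
    Metric.infDist j G ≤ Metric.infDist j F :=
  Metric.infDist_le_infDist_of_subset (Finset.coe_subset.2 h) (by simpa using hF)

theorem serviceCost_insert_client {A : Finset M} {x : M} (hx : x ∉ A) (F : Finset M) :
    serviceCost c (insert x A) F = serviceCost c A F + Metric.infDist x F := by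
  rw [serviceCost, serviceCost, Finset.sum_insert hx]
  ring

theorem serviceCost_insert_facility_le (A : Finset M) {F : Finset M} (hF : F.Nonempty) (a : M)
    {P : Finset M} (hP : P ⊆ A) :
    serviceCost c A (insert a F) + ∑ j ∈ P, Metric.infDist j F ≤
      serviceCost c A F + c a + ∑ j ∈ P, dist a j := by
  have h1 : ∑ f ∈ insert a F, (c f : ℝ) ≤ ∑ f ∈ F, (c f : ℝ) + c a := by
    by_cases ha : a ∈ F
    · rw [Finset.insert_eq_of_mem ha]
      exact le_add_of_nonneg_right (NNReal.coe_nonneg _)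
    · rw [Finset.sum_insert ha, add_comm]
  have h2 : ∑ j ∈ A \ P, Metric.infDist j (insert a F : Finset M) ≤
      ∑ j ∈ A \ P, Metric.infDist j F :=
    Finset.sum_le_sum fun j _ => infDist_le_infDist_finset (Finset.subset_insert a F) hF j
  have h3 : ∑ j ∈ P, Metric.infDist j (insert a F : Finset M) ≤ ∑ j ∈ P, dist a j :=
    Finset.sum_le_sum fun j _ => by
      rw [dist_comm]
      exact Metric.infDist_le_dist_of_mem (by simp)
  rw [serviceCost, serviceCost, ← Finset.sum_sdiff hP, ← Finset.sum_sdiff hP (f := fun j =>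
    Metric.infDist j (F : Set M))]
  linarith

/-- If opening `a` does not pay off for the clients `P`, then the facilities `F` are close to each
client that is close to `a`. -/
theorem card_mul_infDist_le {A F : Finset M} (hF : F.Nonempty) {δ : ℝ} {a : M}
    (h : serviceCost c A F ≤ serviceCost c A (insert a F) + δ) {P : Finset M} (hP : P ⊆ A) (x : M) :
    P.card * Metric.infDist x F ≤ P.card * dist a x + (c a + 2 * ∑ j ∈ P, dist a j) + δ := by
  have h1 := serviceCost_insert_facility_le c A hF a hP
  -- Each `j ∈ P` gives a route from `x` through `a` and `j` to the facility nearest to `j`; the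
  -- routes are averaged over `P`.
  have h2 : ∑ j ∈ P, Metric.infDist x F ≤ ∑ j ∈ P, (dist a x + dist a j + Metric.infDist j F) :=
    Finset.sum_le_sum fun j _ => by
      have h3 := Metric.infDist_le_infDist_add_dist (s := (F : Set M)) (x := x) (y := j)
      have h4 := dist_triangle_left x j a
      linarith
  rw [Finset.sum_add_distrib, Finset.sum_add_distrib, Finset.sum_const, Finset.sum_const,
    nsmul_eq_mul, nsmul_eq_mul] at h2
  linarith

/-- The facility of `F` that is nearest to `x`. -/
def nearestFacility (F : Finset M) (x : M) : M :=
  if h : ∃ f ∈ F, Metric.infDist x F = dist x f then h.choose else x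

theorem nearestFacility_spec {F : Finset M} (hF : F.Nonempty) (x : M) :
    nearestFacility F x ∈ F ∧ Metric.infDist x F = dist x (nearestFacility F x) := by
  have h : ∃ f ∈ F, Metric.infDist x F = dist x f :=
    F.finite_toSet.isCompact.exists_infDist_eq_dist (by simpa using hF) x
  rw [nearestFacility, dif_pos h]
  exact h.choose_spec

/-- The connections after the clients `S` and the arrivals `l`, last arrival first. -/
def connections [Nonempty M] (δ : ℝ) (S : Finset M) : List M → Finset (M × M)
  | [] => S.image fun x => (nearestFacility (facilities c δ S []) x, x)
  | x :: l => if x ∈ S ∪ l.toFinset then connections δ S l else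
      insert (nearestFacility (facilities c δ S (x :: l)) x, x) (connections δ S l)

/-- The solution of the online algorithm for Facility Location. -/
def facilitySolution [Nonempty M] (δ : ℝ) (S : Finset M) (l : List M) : Finset (M ⊕ M × M) :=
  (facilities c δ S l).disjSum (connections c δ S l)

section

variable [Nonempty M] {δ : ℝ} (hδ : 0 < δ)
include hδ

theorem facilitySolution_subset_cons (S : Finset M) (x : M) (l : List M) :
    facilitySolution c δ S l ⊆ facilitySolution c δ S (x :: l) := by
  refine Finset.disjSum_mono (facilities_subset_cons c hδ S x l) ?_
  rw [connections]
  split_ifs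
  · exact subset_rfl
  · exact Finset.subset_insert _ _

theorem facilitySolution_feasible (S : Finset M) (l : List M) :
    (facilitySolution c δ S l : Set (M ⊕ M × M)) ∈
      (facilityLocation M c).feasible {x | x ∈ S ∪ l.toFinset} := by
  induction l with
  | nil =>
    intro x hx
    refine ⟨nearestFacility (facilities c δ S []) x, ?_, ?_⟩
    · simpa [facilitySolution] using (nearestFacility_spec (facilities_nonempty c hδ S []) x).1
    · simpa [facilitySolution, connections] using hx
  | cons y l ih =>
    intro x hx
    by_cases hxl : x ∈ S ∪ l.toFinset
    · obtain ⟨f, hf, hf'⟩ := ih x hxl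
      exact ⟨f, facilitySolution_subset_cons c hδ S y l hf,
        facilitySolution_subset_cons c hδ S y l hf'⟩
    · have hxy : x = y := by
        simp only [Finset.mem_union, List.mem_toFinset, List.mem_cons, Set.mem_ofPred_eq,
          not_or] at hx hxl
        tauto
      subst hxy
      refine ⟨nearestFacility (facilities c δ S (x :: l)) x, ?_, ?_⟩
      · simpa [facilitySolution] using
          (nearestFacility_spec (facilities_nonempty c hδ S (x :: l)) x).1
      · rw [facilitySolution, connections, if_neg hxl]
        simp

/-- Connections are never revised, yet they cost no more than the current service cost up to the
slack: the old facilities were almost optimal for the old clients, so new openings lower the old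
clients' service cost by at most `δ`, and the new client pays exactly its own service distance. -/
theorem sum_connections_le (S : Finset M) (l : List M) :
    ∑ p ∈ connections c δ S l, dist p.1 p.2 ≤
      serviceCost c (S ∪ l.toFinset) (facilities c δ S l) + l.length * δ := by
  induction l with
  | nil =>
    calc ∑ p ∈ connections c δ S [], dist p.1 p.2
        ≤ ∑ x ∈ S, dist (nearestFacility (facilities c δ S []) x) x :=
          Finset.sum_image_le_of_nonneg fun _ _ => dist_nonneg
      _ = ∑ x ∈ S, Metric.infDist x (facilities c δ S []) :=
          Finset.sum_congr rfl fun x _ => by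
            rw [dist_comm, (nearestFacility_spec (facilities_nonempty c hδ S []) x).2]
      _ ≤ _ := by
          simpa [serviceCost] using Finset.sum_nonneg fun _ _ => NNReal.coe_nonneg _
  | cons x l ih =>
    have h := serviceCost_facilities_le c hδ S l (facilities_subset_cons c hδ S x l)
    rw [connections]
    simp only [List.length_cons, Nat.cast_succ]
    split_ifs with hx
    · have : S ∪ (x :: l).toFinset = S ∪ l.toFinset := by
        rw [List.toFinset_cons, Finset.union_insert, Finset.insert_eq_of_mem hx]
      rw [this]
      linarith
    · have hd : ∑ p ∈ insert (nearestFacility (facilities c δ S (x :: l)) x, x)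
          (connections c δ S l), dist p.1 p.2 ≤
          ∑ p ∈ connections c δ S l, dist p.1 p.2 +
            Metric.infDist x (facilities c δ S (x :: l)) := by
        rw [(nearestFacility_spec (facilities_nonempty c hδ S (x :: l)) x).2, dist_comm x]
        by_cases hm : (nearestFacility (facilities c δ S (x :: l)) x, x) ∈ connections c δ S l
        · rw [Finset.insert_eq_of_mem hm]
          exact le_add_of_nonneg_right dist_nonneg
        · rw [Finset.sum_insert hm, add_comm]
      rw [List.toFinset_cons, Finset.union_insert, serviceCost_insert_client c hx]
      linarith

theorem facilitySolution_cost_le (S : Finset M) (l : List M) :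
    (facilityLocation M c).cost (facilitySolution c δ S l : Set (M ⊕ M × M)) ≤
      ENNReal.ofReal (2 * serviceCost c (S ∪ l.toFinset) (facilities c δ S l) + l.length * δ) := by
  have h : (facilityLocation M c).cost (facilitySolution c δ S l : Set (M ⊕ M × M)) =
      ENNReal.ofReal (∑ f ∈ facilities c δ S l, (c f : ℝ) +
        ∑ p ∈ connections c δ S l, dist p.1 p.2) := by
    have : (∑ f ∈ facilities c δ S l, (c f : ℝ) + ∑ p ∈ connections c δ S l, dist p.1 p.2) =
        ((∑ f ∈ facilities c δ S l, c f + ∑ p ∈ connections c δ S l, nndist p.1 p.2 : ℝ≥0) : ℝ) := by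
      push_cast
      rfl
    rw [this, ENNReal.ofReal_coe_nnreal]
    push_cast
    refine (additiveCost_coe_finset _ _).trans ?_
    rw [facilitySolution, Finset.sum_disjSum]
    simp
  rw [h]
  refine ENNReal.ofReal_le_ofReal ?_
  have h1 := sum_connections_le c hδ S l
  have h2 : ∑ f ∈ facilities c δ S l, (c f : ℝ) ≤
      serviceCost c (S ∪ l.toFinset) (facilities c δ S l) :=
    le_add_of_nonneg_right (Finset.sum_nonneg fun _ _ => Metric.infDist_nonneg)
  linarith

end

/-- The cost of the facility `a` and the connections to it, if each client `x ∈ X` is assigned to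
`z x`. -/
def clusterCost (z : M → M) (X : Finset M) (a : M) : ℝ :=
  c a + ∑ x ∈ X with z x = a, dist a x

theorem clusterCost_nonneg (z : M → M) (X : Finset M) (a : M) : 0 ≤ clusterCost c z X a :=
  add_nonneg (NNReal.coe_nonneg _) (Finset.sum_nonneg fun _ _ => dist_nonneg)

/-- The potential of the clients `A ⊆ X` with respect to an assignment `z` of `X`. -/
def clusterPotential (z : M → M) (X A : Finset M) : ℝ :=
  ∑ a ∈ X.image z, 8 * clusterCost c z X a * Real.log (1 + (A.filter (z · = a)).card)

/-- By log x ≥ 1 - 1/x the right side is at least 8/(t + 2), which is at least 4/(t + 1). -/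
theorem inv_le_log_sub_log (t : ℕ) :
    4 / ((t : ℝ) + 1) ≤ 8 * (Real.log (1 + (t + 1 : ℕ)) - Real.log (1 + t)) := by
  have ht : (0 : ℝ) ≤ t := t.cast_nonneg
  rw [← Real.log_div (by positivity) (by positivity)]
  have h := Real.one_sub_inv_le_log_of_pos (x := (1 + ((t + 1 : ℕ) : ℝ)) / (1 + t)) (by positivity)
  refine le_trans ?_ (mul_le_mul_of_nonneg_left h (by norm_num))
  rw [inv_div, div_le_iff₀ (by positivity)]
  push_cast
  rw [one_sub_div (by positivity)]
  rw [mul_div_assoc', div_mul_eq_mul_div, le_div_iff₀ (by positivity)]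
  nlinarith

theorem clusterPotential_insert {z : M → M} {X A : Finset M} {x : M} (hxX : x ∈ X) (hx : x ∉ A) :
    clusterPotential c z X A +
        4 * clusterCost c z X (z x) / ((A.filter (z · = z x)).card + 1) ≤
      clusterPotential c z X (insert x A) := by
  have hz : z x ∈ X.image z := Finset.mem_image_of_mem z hxX
  rw [clusterPotential, clusterPotential, ← Finset.add_sum_erase _ _ hz,
    ← Finset.add_sum_erase _ _ hz]
  have h1 : ∑ a ∈ (X.image z).erase (z x), 8 * clusterCost c z X a *
        Real.log (1 + (A.filter (z · = a)).card) =
      ∑ a ∈ (X.image z).erase (z x), 8 * clusterCost c z X a *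
        Real.log (1 + ((insert x A).filter (z · = a)).card) := by
    refine Finset.sum_congr rfl fun a ha => ?_
    rw [Finset.filter_insert, if_neg (Finset.ne_of_mem_erase ha).symm]
  rw [h1, Finset.filter_insert, if_pos rfl, Finset.card_insert_of_notMem (by simp [hx])]
  have h2 := mul_le_mul_of_nonneg_left (inv_le_log_sub_log (A.filter (z · = z x)).card)
    (clusterCost_nonneg c z X (z x))
  rw [mul_div_assoc', mul_comm _ (4 : ℝ)] at h2
  linarith

section

variable [Nonempty M] {δ : ℝ} (hδ : 0 < δ)
include hδ

/-- Let L be the cluster cost of `z x` and t the number of its clients already present. If t = 0,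
opening `z x` costs at most L. If t ≥ 1, not having opened `z x` shows by `card_mul_infDist_le` that
the existing facilities are within `dist (z x) x` + (2L + δ)/t of `x`. As 2/t ≤ 4/(t + 1), the
growth of the potential pays in both cases. -/
theorem serviceCost_cons_le (S : Finset M) (l : List M) {z : M → M} {X : Finset M} {x : M}
    (hX : S ∪ l.toFinset ⊆ X) (hxX : x ∈ X) (hx : x ∉ S ∪ l.toFinset) :
    serviceCost c (S ∪ (x :: l).toFinset) (facilities c δ S (x :: l)) +
        clusterPotential c z X (S ∪ l.toFinset) ≤
      serviceCost c (S ∪ l.toFinset) (facilities c δ S l) + dist (z x) x +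
        clusterPotential c z X (S ∪ (x :: l).toFinset) + 2 * δ := by
  set F := facilities c δ S l with hF
  set A := S ∪ l.toFinset with hA
  have hFne : F.Nonempty := facilities_nonempty c hδ S l
  have hAx : S ∪ (x :: l).toFinset = insert x A := by
    rw [List.toFinset_cons, Finset.union_insert]
  have hF' : facilities c δ S (x :: l) = extendFacilities c δ (insert x A) F := by
    rw [← hAx]; rfl
  have hpot := clusterPotential_insert c (z := z) hxX hx
  rw [hAx, hF']
  set P := A.filter (z · = z x) with hP
  have hPX : ∑ j ∈ P, dist (z x) j ≤ clusterCost c z X (z x) - c (z x) := by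
    rw [clusterCost, add_sub_cancel_left]
    exact Finset.sum_le_sum_of_subset_of_nonneg (Finset.filter_subset_filter _ hX)
      fun _ _ _ => dist_nonneg
  have hcz : (0 : ℝ) ≤ c (z x) := NNReal.coe_nonneg _
  have hP0 : 0 ≤ ∑ j ∈ P, dist (z x) j := Finset.sum_nonneg fun _ _ => dist_nonneg
  have hL := clusterCost_nonneg c z X (z x)
  have h1 := serviceCost_extendFacilities_le c hδ (insert x A) (Finset.Subset.refl F) hFne
  have h2 := serviceCost_extendFacilities_le c hδ (insert x A) (Finset.subset_insert (z x) F)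
    (Finset.insert_nonempty _ _)
  rw [serviceCost_insert_client c hx F] at h1
  rw [serviceCost_insert_client c hx (insert (z x) F)] at h2
  have h3 : Metric.infDist x (insert (z x) F : Finset M) ≤ dist (z x) x := by
    rw [dist_comm]
    exact Metric.infDist_le_dist_of_mem (by simp)
  have h4 := serviceCost_insert_facility_le c A hFne (z x) (Finset.empty_subset A)
  simp only [Finset.sum_empty, add_zero] at h4
  have h5 := card_mul_infDist_le c hFne
    (serviceCost_facilities_le c hδ S l (Finset.subset_insert (z x) F)) (Finset.filter_subset _ _ :
      P ⊆ A) x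
  rcases Nat.eq_zero_or_pos P.card with h0 | h0
  · rw [h0] at hpot
    simp only [Nat.cast_zero, zero_add, div_one] at hpot
    have : (c (z x) : ℝ) ≤ clusterCost c z X (z x) := by linarith
    linarith
  · have ht : (1 : ℝ) ≤ P.card := by exact_mod_cast h0
    have h6 : Metric.infDist x F ≤ dist (z x) x +
        4 * clusterCost c z X (z x) / (P.card + 1) + δ := by
      have : (P.card : ℝ) * Metric.infDist x F ≤ P.card * (dist (z x) x +
          4 * clusterCost c z X (z x) / (P.card + 1) + δ) := by
        have h7 : 2 * clusterCost c z X (z x) ≤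
            P.card * (4 * clusterCost c z X (z x) / (P.card + 1)) := by
          rw [mul_div_assoc', le_div_iff₀ (by positivity)]
          nlinarith
        nlinarith
      exact le_of_mul_le_mul_left this (by linarith)
    linarith

theorem serviceCost_le (S : Finset M) (l : List M) {z : M → M} {X : Finset M}
    (hX : S ∪ l.toFinset ⊆ X) :
    serviceCost c (S ∪ l.toFinset) (facilities c δ S l) + clusterPotential c z X S ≤
      serviceCost c S (facilities c δ S []) + ∑ x ∈ (S ∪ l.toFinset) \ S, dist (z x) x +
        clusterPotential c z X (S ∪ l.toFinset) + 2 * l.length * δ := by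
  induction l with
  | nil => simp
  | cons x l ih =>
    have hsub : S ∪ l.toFinset ⊆ S ∪ (x :: l).toFinset := by
      rw [List.toFinset_cons, Finset.union_insert]
      exact Finset.subset_insert _ _
    have h := ih (hsub.trans hX)
    simp only [List.length_cons, Nat.cast_succ]
    by_cases hx : x ∈ S ∪ l.toFinset
    · have he : S ∪ (x :: l).toFinset = S ∪ l.toFinset := by
        rw [List.toFinset_cons, Finset.union_insert, Finset.insert_eq_of_mem hx]
      have h1 := serviceCost_extendFacilities_le c hδ (S ∪ (x :: l).toFinset)
        (Finset.Subset.refl (facilities c δ S l)) (facilities_nonempty c hδ S l)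
      rw [he] at h1 ⊢
      have h2 : facilities c δ S (x :: l) =
          extendFacilities c δ (S ∪ l.toFinset) (facilities c δ S l) := by
        rw [← he]; rfl
      rw [h2]
      linarith
    · have h1 := serviceCost_cons_le c hδ S l (z := z) (hsub.trans hX) (hX (by simp)) hx
      have h2 : ∑ y ∈ (S ∪ (x :: l).toFinset) \ S, dist (z y) y =
          dist (z x) x + ∑ y ∈ (S ∪ l.toFinset) \ S, dist (z y) y := by
        have hxS : x ∉ S := fun h => hx (Finset.mem_union_left _ h)
        rw [List.toFinset_cons, Finset.union_insert, Finset.insert_sdiff_of_notMem _ hxS,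
          Finset.sum_insert (by
            rw [Finset.mem_sdiff]
            exact fun h => hx h.1)]
      rw [h2]
      linarith

end

/-- The cost of an assignment of the clients `X` to facilities. -/
def assignmentCost (z : M → M) (X : Finset M) : ℝ :=
  ∑ a ∈ X.image z, (c a : ℝ) + ∑ x ∈ X, dist (z x) x

theorem sum_clusterCost (z : M → M) (X : Finset M) :
    ∑ a ∈ X.image z, clusterCost c z X a = assignmentCost c z X := by
  simp only [clusterCost, assignmentCost, Finset.sum_add_distrib]
  congr 1
  rw [← Finset.sum_fiberwise_of_maps_to (t := X.image z) (g := z)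
    (fun x hx => Finset.mem_image_of_mem z hx)]
  refine Finset.sum_congr rfl fun a _ => Finset.sum_congr rfl fun x hx => ?_
  rw [(Finset.mem_filter.1 hx).2]

theorem assignmentCost_nonneg (z : M → M) (X : Finset M) : 0 ≤ assignmentCost c z X :=
  add_nonneg (Finset.sum_nonneg fun _ _ => NNReal.coe_nonneg _)
    (Finset.sum_nonneg fun _ _ => dist_nonneg)

theorem exists_assignment (X : Finset M) {ε : ℝ} (hε : 0 < ε) :
    ∃ z : M → M, ENNReal.ofReal (assignmentCost c z X) ≤
      (facilityLocation M c).opt X + ENNReal.ofReal ε := by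
  by_cases htop : (facilityLocation M c).opt X = ∞
  · exact ⟨id, by simp [htop]⟩
  have hlt : (facilityLocation M c).opt X < (facilityLocation M c).opt X + ENNReal.ofReal ε :=
    ENNReal.lt_add_right htop (by simpa using hε)
  conv_lhs at hlt => rw [CoverageProblem.opt]
  obtain ⟨T, hT⟩ := iInf_lt_iff.1 hlt
  obtain ⟨hTf, hT⟩ := iInf_lt_iff.1 hT
  have : ∀ x : M, ∃ f, x ∈ X → Sum.inl f ∈ T ∧ Sum.inr (f, x) ∈ T := by
    intro x
    by_cases hx : x ∈ X
    · obtain ⟨f, hf⟩ := hTf x hx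
      exact ⟨f, fun _ => hf⟩
    · exact ⟨x, fun h => absurd h hx⟩
  choose z hz using this
  refine ⟨z, le_trans ?_ hT.le⟩
  let B : Finset (M ⊕ M × M) := (X.image z).disjSum (X.image fun x => (z x, x))
  have hB : (B : Set (M ⊕ M × M)) ⊆ T := by
    intro e he
    rcases Finset.mem_disjSum.1 he with ⟨a, ha, rfl⟩ | ⟨p, hp, rfl⟩
    · obtain ⟨x, hx, rfl⟩ := Finset.mem_image.1 ha
      exact (hz x hx).1
    · obtain ⟨x, hx, rfl⟩ := Finset.mem_image.1 hp
      exact (hz x hx).2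
  refine le_trans (le_of_eq ?_) ((facilityLocation M c).cost_mono hB)
  refine Eq.trans ?_ (additiveCost_coe_finset _ _).symm
  rw [Finset.sum_disjSum, Finset.sum_image (g := fun x => (z x, x)) (by
    intro x _ y _ h
    exact (Prod.ext_iff.1 h).2)]
  have : assignmentCost c z X =
      ((∑ a ∈ X.image z, c a + ∑ x ∈ X, nndist (z x) x : ℝ≥0) : ℝ) := by
    push_cast
    rfl
  rw [this, ENNReal.ofReal_coe_nnreal]
  push_cast
  simp

theorem serviceCost_image_le (z : M → M) (X : Finset M) :
    serviceCost c X (X.image z) ≤ assignmentCost c z X := by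
  refine add_le_add le_rfl (Finset.sum_le_sum fun x hx => ?_)
  rw [dist_comm]
  exact Metric.infDist_le_dist_of_mem (by simpa using ⟨x, hx, rfl⟩)

end FacilityLocation

/-! ### Logarithm estimates and summation of the expected cost -/

/-- The tangent of the concave logarithm at `K`. The slope 1/(1 + K) is what cancels the loss of the
exchange argument. -/
theorem log_one_add_le {K y : ℝ} (hK : 0 ≤ K) (hy : 0 ≤ y) :
    Real.log (1 + y) ≤ Real.log (1 + K) + y / (1 + K) := by
  have h1 : (0 : ℝ) < 1 + K := by linarith
  have h := Real.log_le_sub_one_of_pos (x := (1 + y) / (1 + K)) (by positivity)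
  rw [Real.log_div (by positivity) (by positivity)] at h
  have h2 : (1 + y) / (1 + K) - 1 ≤ y / (1 + K) := by
    rw [div_sub_one (by positivity)]
    gcongr
    linarith
  linarith

theorem log_one_add_exp_le {x : ℝ} (hx : 0 ≤ x) : Real.log (1 + Real.exp x) ≤ 1 + x := by
  rw [Real.log_le_iff_le_exp (by positivity), Real.exp_add]
  have h1 := Real.add_one_le_exp (1 : ℝ)
  have h2 := Real.one_le_exp hx
  nlinarith

section

variable {V E : Type*} {n : ℕ} {Ω : Fin n → Set V} {P : CoverageProblem V E}

/-- The expected cost of an algorithm that pays for the optimum of the sample, for `O(Δ)` times the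
joint optimum, and for an amount `Φ` that is bounded by an exchange argument. -/
theorem tsum_cost_le (D : PMF ((i : Fin n) → Ω i)) {Δ : ℝ≥0} {ε : ℝ≥0∞}
    {cost Φ : ((i : Fin n) → Ω i) × ((i : Fin n) → Ω i) → ℝ≥0∞} {B K : ℝ≥0∞}
    (hcost : ∀ x, cost x ≤ 2 * (P.opt (demandPoints x.1) + ε) +
      (18 + 64 * Δ) * (P.opt (jointDemandPoints x) + ε) + B * Φ x + ε)
    (hΦ : ∑' x, D x.1 * D x.2 * Φ x ≤
      K * ∑' x : ((i : Fin n) → Ω i) × ((i : Fin n) → Ω i),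
        D x.1 * D x.2 * (P.opt (jointDemandPoints x) + ε)) (hBK : B * K ≤ 16) :
    ∑' x, D x.1 * D x.2 * cost x ≤ (128 * (1 + Δ) : ℝ≥0) * (P.expectedOpt D + ε) := by
  have h1 : ∑' x : ((i : Fin n) → Ω i) × ((i : Fin n) → Ω i),
      D x.1 * D x.2 * (P.opt (demandPoints x.1) + ε) = P.expectedOpt D + ε := by
    simp_rw [mul_add]
    rw [ENNReal.tsum_add, PMF.tsum_prod_mul_const, ENNReal.tsum_prod']
    congr 1
    simp_rw [mul_right_comm _ (D _), ENNReal.tsum_mul_left, D.tsum_coe, mul_one, coe_demandPoints]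
    rfl
  have h2 : ∑' x : ((i : Fin n) → Ω i) × ((i : Fin n) → Ω i),
      D x.1 * D x.2 * (P.opt (jointDemandPoints x) + ε) ≤ 2 * P.expectedOpt D + ε := by
    simp_rw [mul_add]
    rw [ENNReal.tsum_add, PMF.tsum_prod_mul_const]
    exact add_le_add (P.tsum_opt_jointDemandPoints_le D) le_rfl
  calc _ ≤ ∑' x : ((i : Fin n) → Ω i) × ((i : Fin n) → Ω i),
      (2 * (D x.1 * D x.2 * (P.opt (demandPoints x.1) + ε)) +
        (18 + 64 * Δ) * (D x.1 * D x.2 * (P.opt (jointDemandPoints x) + ε)) +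
        B * (D x.1 * D x.2 * Φ x) + D x.1 * D x.2 * ε) := by
        refine ENNReal.tsum_le_tsum fun x => ?_
        refine (mul_le_mul_right (hcost x) _).trans (le_of_eq ?_)
        ring
    _ = 2 * (P.expectedOpt D + ε) +
        (18 + 64 * Δ) * (∑' x : ((i : Fin n) → Ω i) × ((i : Fin n) → Ω i),
          D x.1 * D x.2 * (P.opt (jointDemandPoints x) + ε)) +
        B * (∑' x, D x.1 * D x.2 * Φ x) + ε := by
        rw [ENNReal.tsum_add, ENNReal.tsum_add, ENNReal.tsum_add, ENNReal.tsum_mul_left,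
          ENNReal.tsum_mul_left, ENNReal.tsum_mul_left, PMF.tsum_prod_mul_const, h1]
    _ ≤ 2 * (P.expectedOpt D + ε) + (18 + 64 * Δ) * (2 * P.expectedOpt D + ε) +
        16 * (2 * P.expectedOpt D + ε) + ε := by
        refine add_le_add (add_le_add (add_le_add le_rfl (mul_le_mul_right h2 _)) ?_) le_rfl
        refine (mul_le_mul_right hΦ _).trans ?_
        rw [← mul_assoc]
        exact mul_le_mul' hBK h2
    -- 70 + 128Δ = 2 + 2(18 + 64Δ) + 2 · 16, the factors 2 coming from OPT(X) ≤ OPT(s) + OPT(u).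
    _ = (70 + 128 * Δ) * P.expectedOpt D + (37 + 64 * Δ) * ε := by ring
    _ ≤ (128 + 128 * Δ) * P.expectedOpt D + (128 + 128 * Δ) * ε := by
        gcongr <;> norm_num
    _ = _ := by push_cast; ring

end

/-! ### Facility Location: the growth of the potential in expectation -/

section FacilityLocation

open scoped Classical

variable {M : Type*} [PseudoMetricSpace M] (c : M → ℝ≥0)

/-- For a cluster with s sample clients and t others, the logarithms differ by log(1 + t/(s + 1)).
After the tangent bound, each of the t others carries 1/(s + 1) of the cluster cost. -/
theorem clusterPotential_sub_le {z : M → M} {X S : Finset M} (hS : S ⊆ X) {K : ℝ} (hK : 0 ≤ K) :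
    clusterPotential c z X X - clusterPotential c z X S ≤
      8 * Real.log (1 + K) * assignmentCost c z X + 8 / (1 + K) *
        ∑ x ∈ X \ S, clusterCost c z X (z x) / ((S.filter (z · = z x)).card + 1) := by
  have h1 : ∑ x ∈ X \ S, clusterCost c z X (z x) / ((S.filter (z · = z x)).card + 1) =
      ∑ a ∈ X.image z, ((X \ S).filter (z · = a)).card *
        (clusterCost c z X a / ((S.filter (z · = a)).card + 1)) := by
    rw [← Finset.sum_fiberwise_of_maps_to (t := X.image z) (g := z)
      (fun x hx => Finset.mem_image_of_mem z (Finset.mem_sdiff.1 hx).1)]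
    refine Finset.sum_congr rfl fun a _ => ?_
    rw [← nsmul_eq_mul, ← Finset.sum_const]
    refine Finset.sum_congr rfl fun x hx => ?_
    rw [(Finset.mem_filter.1 hx).2]
  rw [h1, ← sum_clusterCost, clusterPotential, clusterPotential, ← Finset.sum_sub_distrib,
    Finset.mul_sum, Finset.mul_sum, ← Finset.sum_add_distrib]
  refine Finset.sum_le_sum fun a _ => ?_
  have hcard : ((X.filter (z · = a)).card : ℝ) =
      ((X \ S).filter (z · = a)).card + (S.filter (z · = a)).card := by
    rw [← Nat.cast_add, ← Finset.card_union_of_disjoint, ← Finset.filter_union,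
      Finset.sdiff_union_of_subset hS]
    exact Finset.disjoint_filter_filter Finset.sdiff_disjoint
  rw [hcard]
  set s : ℝ := ((S.filter (z · = a)).card : ℝ) with hs
  set t : ℝ := (((X \ S).filter (z · = a)).card : ℝ) with ht
  have hs0 : 0 ≤ s := Nat.cast_nonneg _
  have ht0 : 0 ≤ t := Nat.cast_nonneg _
  have hL := clusterCost_nonneg c z X a
  have h2 := log_one_add_le hK (y := t / (s + 1)) (by positivity)
  have h3 : 1 + t / (s + 1) = (1 + (t + s)) / (1 + s) := by
    field_simp
    ring
  rw [h3, Real.log_div (by positivity) (by positivity)] at h2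
  calc _ = 8 * clusterCost c z X a * (Real.log (1 + (t + s)) - Real.log (1 + s)) := by ring
    _ ≤ 8 * clusterCost c z X a * (Real.log (1 + K) + t / (s + 1) / (1 + K)) := by gcongr
    _ = _ := by ring

/-- The receiving side of the exchange: the sample clients of a cluster share its cost equally, so
every cluster is counted at most once. -/
theorem sum_clusterCost_div_le {z : M → M} {X S : Finset M} (hS : S ⊆ X) :
    ∑ x ∈ S, clusterCost c z X (z x) / (S.filter (z · = z x)).card ≤ assignmentCost c z X := by
  rw [← Finset.sum_fiberwise_of_maps_to (t := X.image z) (g := z)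
      (fun x hx => Finset.mem_image_of_mem z (hS hx)), ← sum_clusterCost]
  refine Finset.sum_le_sum fun a _ => ?_
  have : ∑ x ∈ S with z x = a, clusterCost c z X (z x) / (S.filter (z · = z x)).card =
      ∑ x ∈ S with z x = a, clusterCost c z X a / (S.filter (z · = a)).card :=
    Finset.sum_congr rfl fun x hx => by rw [(Finset.mem_filter.1 hx).2]
  rw [this, Finset.sum_const, nsmul_eq_mul]
  rcases Nat.eq_zero_or_pos (S.filter (z · = a)).card with h0 | h0
  · simpa [h0] using clusterCost_nonneg c z X a
  · rw [mul_div_cancel₀ _ (by positivity)]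

theorem facilitySolution_cost_le_of_assignment [Nonempty M] {δ : ℝ} (hδ : 0 < δ) (S : Finset M)
    (hS : S.Nonempty) (l : List M) (z z' : M → M) {K : ℝ} (hK : 0 ≤ K) :
    (facilityLocation M c).cost (facilitySolution c δ S l : Set (M ⊕ M × M)) ≤
      ENNReal.ofReal (2 * assignmentCost c z' S +
        (2 + 16 * Real.log (1 + K)) * assignmentCost c z (S ∪ l.toFinset) + 16 / (1 + K) *
        ∑ x ∈ (S ∪ l.toFinset) \ S, clusterCost c z (S ∪ l.toFinset) (z x) /
          ((S.filter (z · = z x)).card + 1) + (5 * l.length + 2) * δ) := by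
  refine (facilitySolution_cost_le c hδ S l).trans (ENNReal.ofReal_le_ofReal ?_)
  have h1 := serviceCost_le c hδ S l (z := z) (Finset.Subset.refl _)
  have h2 := clusterPotential_sub_le c (z := z) (X := S ∪ l.toFinset) Finset.subset_union_left hK
  have h3 : ∑ x ∈ (S ∪ l.toFinset) \ S, dist (z x) x ≤ assignmentCost c z (S ∪ l.toFinset) :=
    (Finset.sum_le_sum_of_subset_of_nonneg Finset.sdiff_subset fun _ _ _ => dist_nonneg).trans
      (le_add_of_nonneg_left (Finset.sum_nonneg fun _ _ => NNReal.coe_nonneg _))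
  have h4 : serviceCost c S (facilities c δ S []) ≤ assignmentCost c z' S + δ :=
    (serviceCost_extendFacilities_le c hδ S (Finset.empty_subset (S.image z'))
      (hS.image z')).trans (add_le_add_left (serviceCost_image_le c z' S) δ)
  have h5 : 16 / (1 + K) = 2 * (8 / (1 + K)) := by ring
  rw [h5]
  linarith

/-- Facility Location has `O(Δ)`-competitive algorithms up to an arbitrarily small error. -/
theorem facilityLocation_approx {n : ℕ} (hn : n ≠ 0) {Ω : Fin n → Set M}
    {D : PMF ((i : Fin n) → Ω i)} {Δ : ℝ≥0} (hD : IsMRFDistribution D Δ) {ε : ℝ} (hε : 0 < ε) :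
    ∃ T : ((i : Fin n) → Ω i) → List M → Set (M ⊕ M × M), (∀ s x l, T s l ⊆ T s (x :: l)) ∧
      (∀ s l, (∀ x ∈ l, ∃ i, x ∈ Ω i) → T s l ∈ (facilityLocation M c).feasible {x | x ∈ l}) ∧
      ∑' x : ((i : Fin n) → Ω i) × ((i : Fin n) → Ω i), D x.1 * D x.2 *
        (facilityLocation M c).cost (T x.1 (List.ofFn fun i => (x.2 i : M)).reverse) ≤
          (128 * (1 + Δ) : ℝ≥0) * ((facilityLocation M c).expectedOpt D + ENNReal.ofReal ε) := by
  have hpos : 0 < n := Nat.pos_of_ne_zero hn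
  obtain ⟨u₀, -⟩ := D.support_nonempty
  have hM : Nonempty M := ⟨u₀ ⟨0, hpos⟩⟩
  -- Per arrival: `2δ` in the service cost, which is counted twice, and `δ` in the connections. The
  -- start contributes another `δ`, also counted twice.
  set δ : ℝ := ε / (5 * n + 2) with hδdef
  have hδ : 0 < δ := by positivity
  have hδε : (5 * n + 2) * δ = ε := by
    rw [hδdef]
    field_simp
  refine ⟨fun s l => facilitySolution c δ (demandPoints s) l,
    fun s x l => Finset.coe_subset.2 (facilitySolution_subset_cons c hδ _ x l), ?_, ?_⟩
  · intro s l _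
    refine (facilityLocation M c).feasible_anti ?_ (facilitySolution_feasible c hδ _ l)
    intro x hx
    exact Finset.mem_union_right (demandPoints s) (List.mem_toFinset.2 hx)
  -- The assignments serve the analysis only; the algorithm does not see the joint set in advance.
  choose z hz using fun X : Finset M => exists_assignment c X hε
  set K : ℝ := Real.exp (4 * Δ) with hKdef
  have hK : 0 ≤ K := (Real.exp_pos _).le
  let φ : ((i : Fin n) → Ω i) × ((i : Fin n) → Ω i) → M → ℝ≥0∞ := fun x p =>
    ENNReal.ofReal (clusterCost c (z (jointDemandPoints x)) (jointDemandPoints x)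
      (z (jointDemandPoints x) p) / (((demandPoints x.1).filter
        (z (jointDemandPoints x) · = z (jointDemandPoints x) p)).card + 1))
  let ψ : ((i : Fin n) → Ω i) × ((i : Fin n) → Ω i) → M → ℝ≥0∞ := fun x p =>
    ENNReal.ofReal (clusterCost c (z (jointDemandPoints x)) (jointDemandPoints x)
      (z (jointDemandPoints x) p) / ((demandPoints x.1).filter
        (z (jointDemandPoints x) · = z (jointDemandPoints x) p)).card)
  have hexch := tsum_exchange_le D (fun i x => hD.mul_le i x) φ ψ (by
    intro x i hxi
    simp only [φ, ψ, jointDemandPoints_exchangeCoord]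
    refine ENNReal.ofReal_le_ofReal ?_
    set w := z (jointDemandPoints x)
    have hmem := mem_demandPoints_exchangeCoord i x
    -- The exchange adds at most one sample client to the cluster, which turns the denominator |S_a|
    -- + 1 into an upper bound for the new |S_a|.
    refine div_le_div_of_nonneg_left (clusterCost_nonneg c _ _ _) ?_ ?_
    · exact Nat.cast_pos.2 (Finset.card_pos.2 ⟨(x.2 i : M), by simpa using hmem⟩)
    · norm_cast
      calc _ ≤ ((insert (x.2 i : M) (demandPoints x.1)).filter (w · = w (x.2 i))).card :=
            Finset.card_le_card (Finset.filter_subset_filter _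
              (demandPoints_exchangeCoord_subset i x))
        _ ≤ _ := by
            rw [Finset.filter_insert, if_pos rfl]
            exact Finset.card_insert_le _ _)
  -- With K = e^{4Δ}, 2 + 16 log(1 + K) ≤ 18 + 64Δ and 16K/(1 + K) ≤ 16.
  refine tsum_cost_le D (B := ENNReal.ofReal (16 / (1 + K))) (K := ENNReal.ofReal K)
    (Φ := fun x => ∑ p ∈ jointDemandPoints x \ demandPoints x.1, φ x p) ?_ ?_ ?_
  · intro x
    have hl : demandPoints x.1 ∪ (List.ofFn fun i => (x.2 i : M)).reverse.toFinset =
        jointDemandPoints x := by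
      ext p
      simp [jointDemandPoints, mem_demandPoints]
    have h := facilitySolution_cost_le_of_assignment c hδ (demandPoints x.1)
      ⟨_, mem_demandPoints.2 ⟨⟨0, hpos⟩, rfl⟩⟩ (List.ofFn fun i => (x.2 i : M)).reverse
      (z (jointDemandPoints x)) (z (demandPoints x.1)) hK
    rw [hl, List.length_reverse, List.length_ofFn, hδε] at h
    refine h.trans ?_
    have hlog : Real.log (1 + K) ≤ 1 + 4 * Δ := log_one_add_exp_le (by positivity)
    have hlog0 : 0 ≤ Real.log (1 + K) := Real.log_nonneg (by linarith)
    have hΦ0 : ∀ p ∈ jointDemandPoints x \ demandPoints x.1,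
        0 ≤ clusterCost c (z (jointDemandPoints x)) (jointDemandPoints x)
      (z (jointDemandPoints x) p) / (((demandPoints x.1).filter
        (z (jointDemandPoints x) · = z (jointDemandPoints x) p)).card + 1 : ℝ) := fun p _ =>
      div_nonneg (clusterCost_nonneg c _ _ _) (by positivity)
    have ha := assignmentCost_nonneg c (z (demandPoints x.1)) (demandPoints x.1)
    have hb := assignmentCost_nonneg c (z (jointDemandPoints x)) (jointDemandPoints x)
    rw [ENNReal.ofReal_add (by
        have := Finset.sum_nonneg hΦ0
        positivity) hε.le, ENNReal.ofReal_add (by positivity) (by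
        have := Finset.sum_nonneg hΦ0
        positivity), ENNReal.ofReal_add (by positivity) (by positivity),
      ENNReal.ofReal_mul (by norm_num), ENNReal.ofReal_mul (by positivity),
      ENNReal.ofReal_mul (by positivity), ENNReal.ofReal_sum_of_nonneg hΦ0]
    gcongr
    · norm_num
    · exact hz _
    · have h18 : (18 + 64 * Δ : ℝ≥0∞) = ENNReal.ofReal (18 + 64 * Δ) := by
        rw [ENNReal.ofReal_add (by norm_num) (by positivity), ENNReal.ofReal_mul (by norm_num)]
        simp
      rw [h18]
      refine ENNReal.ofReal_le_ofReal ?_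
      linarith
    · exact hz _
  · refine hexch.trans (mul_le_mul_right (ENNReal.tsum_le_tsum fun x => ?_) _)
    refine mul_le_mul_right (le_trans ?_ (hz (jointDemandPoints x))) _
    rw [← ENNReal.ofReal_sum_of_nonneg fun p _ => div_nonneg (clusterCost_nonneg c _ _ _)
      (Nat.cast_nonneg _)]
    exact ENNReal.ofReal_le_ofReal (sum_clusterCost_div_le c Finset.subset_union_left)
  · rw [← ENNReal.ofReal_mul (by positivity), ← ENNReal.ofReal_ofNat]
    refine ENNReal.ofReal_le_ofReal ?_
    rw [div_mul_eq_mul_div, div_le_iff₀ (by positivity)]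
    linarith

end FacilityLocation

theorem facilityLocation_exists_isCompetitive {M : Type*} [PseudoMetricSpace M] (c : M → ℝ≥0)
    {n : ℕ} {Ω : Fin n → Set M} {D : PMF ((i : Fin n) → Ω i)} {Δ : ℝ≥0}
    (hD : IsMRFDistribution D Δ)
    (hopt : ∀ i, ∀ v ∈ Ω i, (facilityLocation M c).HasOptimalSolution {v}) :
    ∃ R : RandomizedOnlineAlgorithm M (M ⊕ M × M),
      R.IsCompetitive (facilityLocation M c) D (2 * (128 * (1 + Δ))) :=
  exists_isCompetitive_of_approx (fun _ h => h.elim) (additiveCost_empty _) D hD.ne_zero hopt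
    (by positivity) fun hn _ _ hε => facilityLocation_approx c hn hD hε

/-! ## Inserting points greedily on a line -/

section Line

/-- `q` separates the position `p` from the gap between `f` and `f + 1`, or equals `p`. -/
def Separates (q p f : ℕ) : Prop := (f < q ∧ q ≤ p) ∨ (p ≤ q ∧ q ≤ f)

/-- No position of `Q` separates `p` from the gap `f`. -/
def Visible (Q : Finset ℕ) (p f : ℕ) : Prop := ∀ q ∈ Q, ¬ Separates q p f

theorem Visible.anti {Q Q' : Finset ℕ} (h : Q ⊆ Q') {p f : ℕ} (hv : Visible Q' p f) :
    Visible Q p f := fun q hq => hv q (h hq)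

theorem not_visible_of_mem {Q : Finset ℕ} {p : ℕ} (hp : p ∈ Q) (f : ℕ) : ¬ Visible Q p f := by
  intro h
  refine h p hp ?_
  rcases lt_or_ge f p with hf | hf
  · exact Or.inl ⟨hf, le_rfl⟩
  · exact Or.inr ⟨le_rfl, hf⟩

open Classical in
/-- The number of the positions of `R` in the interval of `Q` that contains the gap `f`. -/
def visibleCount (Q R : Finset ℕ) (f : ℕ) : ℕ := (R.filter fun p => Visible Q p f).card

theorem visibleCount_anti {Q Q' : Finset ℕ} (h : Q ⊆ Q') (R : Finset ℕ) (f : ℕ) :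
    visibleCount Q' R f ≤ visibleCount Q R f := by
  classical
  exact Finset.card_le_card (Finset.monotone_filter_right _ fun _ _ hv => hv.anti h)

/-- The potential of a gap. -/
def gapPotential (Q R : Finset ℕ) (f : ℕ) : ℝ := Real.logb 2 (1 + visibleCount Q R f)

theorem gapPotential_anti {Q Q' : Finset ℕ} (h : Q ⊆ Q') (R : Finset ℕ) (f : ℕ) :
    gapPotential Q' R f ≤ gapPotential Q R f := by
  refine Real.logb_le_logb_of_le (by norm_num) (by positivity) ?_
  have : (visibleCount Q' R f : ℝ) ≤ visibleCount Q R f := by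
    exact_mod_cast visibleCount_anti h R f
  linarith

theorem gapPotential_nonneg (Q R : Finset ℕ) (f : ℕ) : 0 ≤ gapPotential Q R f :=
  Real.logb_nonneg (by norm_num) (by simp)

/-- Base 2 makes one halving worth one unit, so a gap pays its full length whenever its count
halves. -/
theorem one_le_gapPotential_sub {Q Q' R : Finset ℕ} {f : ℕ}
    (h : 2 * (1 + visibleCount Q' R f) ≤ 1 + visibleCount Q R f) :
    1 ≤ gapPotential Q R f - gapPotential Q' R f := by
  have h' : (2 * (1 + visibleCount Q' R f) : ℝ) ≤ 1 + visibleCount Q R f := by exact_mod_cast h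
  have h1 := Real.logb_le_logb_of_le (b := 2) (by norm_num) (by positivity) h'
  rw [Real.logb_mul (by norm_num) (by positivity), Real.logb_self_eq_one (by norm_num)] at h1
  rw [gapPotential, gapPotential]
  linarith

/-- The distance of two positions on a line with gaps of length `ℓ`. -/
def lineDist (ℓ : ℕ → ℝ≥0) (p q : ℕ) : ℝ := ∑ f ∈ Finset.Ico (min p q) (max p q), (ℓ f : ℝ)

/-- A new position is not farther from the previous ones than the decrease of the potential: it
can be connected to the side on which at least half of the other new positions vanish. -/
theorem exists_lineDist_le (ℓ : ℕ → ℝ≥0) {N : ℕ} {Q R : Finset ℕ} (h0 : 0 ∈ Q) (hN : N ∈ Q)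
    {p : ℕ} (hpN : p ≤ N) (hpR : p ∈ R) :
    ∃ q ∈ Q, lineDist ℓ p q ≤
      ∑ f ∈ Finset.range N, ℓ f * (gapPotential Q R f - gapPotential (insert p Q) R f) := by
  classical
  by_cases hpQ : p ∈ Q
  · exact ⟨p, hpQ, by simp [lineDist, Finset.insert_eq_of_mem hpQ]⟩
  have hlow : (Q.filter (· < p)).Nonempty :=
    ⟨0, Finset.mem_filter.2 ⟨h0, Nat.pos_of_ne_zero (by rintro rfl; exact hpQ h0)⟩⟩
  have hhigh : (Q.filter (p < ·)).Nonempty :=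
    ⟨N, Finset.mem_filter.2 ⟨hN, lt_of_le_of_ne hpN (by rintro rfl; exact hpQ hN)⟩⟩
  -- `a` and `b` are the neighbours of `p` in `Q`; only gaps between them are affected.
  obtain ⟨a, ha, hamax⟩ := (Q.filter (· < p)).exists_max_image id hlow
  obtain ⟨b, hb, hbmin⟩ := (Q.filter (p < ·)).exists_min_image id hhigh
  rw [Finset.mem_filter] at ha hb
  have hgap : ∀ q ∈ Q, q ≤ a ∨ b ≤ q := by
    intro q hq
    rcases lt_trichotomy q p with h | rfl | h
    · exact Or.inl (hamax q (Finset.mem_filter.2 ⟨hq, h⟩))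
    · exact absurd hq hpQ
    · exact Or.inr (hbmin q (Finset.mem_filter.2 ⟨hq, h⟩))
  have hbN : b ≤ N := hbmin N (Finset.mem_filter.2 ⟨hN, by
    exact lt_of_le_of_ne hpN (by rintro rfl; exact hpQ hN)⟩)
  set R₁ := R.filter fun x => a < x ∧ x < p with hR₁
  set R₂ := R.filter fun x => p < x ∧ x < b with hR₂
  -- The extra 1 is `p` itself. It makes the smaller side satisfy 2(1 + min) ≤ 1 + (|R₁| + |R₂| +
  -- 1).
  have hbig : ∀ f, a ≤ f → f < b → R₁.card + R₂.card + 1 ≤ visibleCount Q R f := by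
    intro f hf1 hf2
    have hd : Disjoint R₁ R₂ := by
      rw [Finset.disjoint_left]
      intro x hx1 hx2
      have := (Finset.mem_filter.1 hx1).2
      have := (Finset.mem_filter.1 hx2).2
      omega
    have hp : p ∉ R₁ ∪ R₂ := by simp [hR₁, hR₂]
    rw [← Finset.card_union_of_disjoint hd, ← Finset.card_insert_of_notMem hp]
    refine Finset.card_le_card fun x hx => Finset.mem_filter.2 ?_
    have hx' : x ∈ R ∧ a < x ∧ x < b := by
      simp only [hR₁, hR₂, Finset.mem_insert, Finset.mem_union, Finset.mem_filter] at hx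
      rcases hx with rfl | ⟨h1, h2⟩ | ⟨h1, h2⟩
      · exact ⟨hpR, ha.2, hb.2⟩
      · exact ⟨h1, h2.1, h2.2.trans hb.2⟩
      · exact ⟨h1, ha.2.trans h2.1, h2.2⟩
    refine ⟨hx'.1, fun q hq hs => ?_⟩
    have := hgap q hq
    unfold Separates at hs
    omega
  have hleft : ∀ f, a ≤ f → f < p → visibleCount (insert p Q) R f ≤ R₁.card := by
    intro f hf1 hf2
    refine Finset.card_le_card fun x hx => ?_
    rw [Finset.mem_filter] at hx
    have h1 := hx.2 p (Finset.mem_insert_self _ _)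
    have h2 := hx.2 a (Finset.mem_insert_of_mem ha.1)
    unfold Separates at h1 h2
    exact Finset.mem_filter.2 ⟨hx.1, by omega, by omega⟩
  have hright : ∀ f, p ≤ f → f < b → visibleCount (insert p Q) R f ≤ R₂.card := by
    intro f hf1 hf2
    refine Finset.card_le_card fun x hx => ?_
    rw [Finset.mem_filter] at hx
    have h1 := hx.2 p (Finset.mem_insert_self _ _)
    have h2 := hx.2 b (Finset.mem_insert_of_mem hb.1)
    unfold Separates at h1 h2
    exact Finset.mem_filter.2 ⟨hx.1, by omega, by omega⟩
  have hsum : ∀ I ⊆ Finset.range N,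
      (∀ f ∈ I, 2 * (1 + visibleCount (insert p Q) R f) ≤ 1 + visibleCount Q R f) →
      ∑ f ∈ I, (ℓ f : ℝ) ≤
        ∑ f ∈ Finset.range N, ℓ f * (gapPotential Q R f - gapPotential (insert p Q) R f) := by
    intro I hI h
    calc ∑ f ∈ I, (ℓ f : ℝ)
        ≤ ∑ f ∈ I, ℓ f * (gapPotential Q R f - gapPotential (insert p Q) R f) :=
          Finset.sum_le_sum fun f hf =>
            le_mul_of_one_le_right (NNReal.coe_nonneg _) (one_le_gapPotential_sub (h f hf))
      _ ≤ _ := Finset.sum_le_sum_of_subset_of_nonneg hI fun f _ _ =>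
          mul_nonneg (NNReal.coe_nonneg _)
            (sub_nonneg.2 (gapPotential_anti (Finset.subset_insert p Q) R f))
  rcases le_total R₁.card R₂.card with hc | hc
  · refine ⟨a, ha.1, hsum _ ?_ ?_⟩
    · intro f hf
      rw [Finset.mem_Ico] at hf
      rw [Finset.mem_range]
      omega
    · intro f hf
      rw [Finset.mem_Ico] at hf
      have h1 := hbig f (by omega) (by omega)
      have h2 := hleft f (by omega) (by omega)
      omega
  · refine ⟨b, hb.1, hsum _ ?_ ?_⟩
    · intro f hf
      rw [Finset.mem_Ico] at hf
      rw [Finset.mem_range]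
      omega
    · intro f hf
      rw [Finset.mem_Ico] at hf
      have h1 := hbig f (by omega) (by omega)
      have h2 := hright f (by omega) (by omega)
      omega

open Classical in
/-- At most two positions of `Q` are next to a given gap. -/
theorem card_visible_erase_le_two (Q : Finset ℕ) (f : ℕ) :
    (Q.filter fun q => Visible (Q.erase q) q f).card ≤ 2 := by
  rw [← Finset.card_filter_add_card_filter_not (s := Q.filter fun q => Visible (Q.erase q) q f)
    (fun q => f < q)]
  -- One position on each side of the gap: of two on the same side, the nearer one hides the farther
  -- one.
  refine add_le_add (b := 1) (d := 1) (Finset.card_le_one.2 ?_) (Finset.card_le_one.2 ?_)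
  · intro q hq q' hq'
    simp only [Finset.mem_filter] at hq hq'
    by_contra hne
    have h1 := hq.1.2 q' (Finset.mem_erase.2 ⟨Ne.symm hne, hq'.1.1⟩)
    have h2 := hq'.1.2 q (Finset.mem_erase.2 ⟨hne, hq.1.1⟩)
    unfold Separates at h1 h2
    omega
  · intro q hq q' hq'
    simp only [Finset.mem_filter] at hq hq'
    by_contra hne
    have h1 := hq.1.2 q' (Finset.mem_erase.2 ⟨Ne.symm hne, hq'.1.1⟩)
    have h2 := hq'.1.2 q (Finset.mem_erase.2 ⟨hne, hq.1.1⟩)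
    unfold Separates at h1 h2
    omega

/-- The factor 2 bounds 1/log 2. -/
theorem gapPotential_le {K : ℝ} (hK : 0 ≤ K) (Q R : Finset ℕ) (f : ℕ) :
    gapPotential Q R f ≤ 2 * (Real.log (1 + K) + visibleCount Q R f / (1 + K)) := by
  refine le_trans ?_ (mul_le_mul_of_nonneg_left
    (log_one_add_le hK (Nat.cast_nonneg (visibleCount Q R f))) (by norm_num))
  have h2 := Real.log_two_gt_d9
  have hl : 0 ≤ Real.log (1 + (visibleCount Q R f : ℝ)) := Real.log_nonneg (by simp)
  rw [gapPotential, ← Real.log_div_log, div_le_iff₀ (by linarith)]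
  nlinarith

end Line

/-! ## Tours in graphs -/

section Tour

open scoped Classical

variable {V : Type*} {G : SimpleGraph V} (w : G.edgeSet → ℝ≥0)

/-- The cost of an edge, as a function on all unordered pairs. -/
def edgeCost (e : Sym2 V) : ℝ≥0 := if h : e ∈ G.edgeSet then w ⟨e, h⟩ else 0

theorem edgeCost_coe (e : G.edgeSet) : edgeCost w e = w e := by
  simp [edgeCost]

/-- The cost of a walk. -/
def walkCost {a b : V} (p : G.Walk a b) : ℝ≥0 := (p.edges.map (edgeCost w)).sum

theorem walkCost_nil (a : V) : walkCost w (SimpleGraph.Walk.nil : G.Walk a a) = 0 := by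
  simp [walkCost]

theorem walkCost_cons {a b d : V} (h : G.Adj a b) (p : G.Walk b d) :
    walkCost w (SimpleGraph.Walk.cons h p) = edgeCost w s(a, b) + walkCost w p := by
  simp [walkCost]

theorem walkCost_append {a b d : V} (p : G.Walk a b) (q : G.Walk b d) :
    walkCost w (p.append q) = walkCost w p + walkCost w q := by
  simp [walkCost]

theorem walkCost_reverse {a b : V} (p : G.Walk a b) : walkCost w p.reverse = walkCost w p := by
  simp [walkCost]

/-- The edges of a walk. -/
def walkEdges {a b : V} (p : G.Walk a b) : Set G.edgeSet := {e | (e : Sym2 V) ∈ p.edges}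

theorem additiveCost_walkEdges_le {a b : V} (p : G.Walk a b) :
    additiveCost w (walkEdges p) ≤ walkCost w p := by
  induction p with
  | nil => simp [walkEdges, additiveCost]
  | @cons a b d h p ih =>
    have : walkEdges (SimpleGraph.Walk.cons h p) ⊆
        (({⟨s(a, b), h⟩} : Finset G.edgeSet) : Set G.edgeSet) ∪ walkEdges p := by
      intro e he
      simp only [walkEdges, SimpleGraph.Walk.edges_cons, List.mem_cons] at he
      rcases he with he | he
      · left
        simpa using Subtype.ext he
      · exact Or.inr he
    refine (additiveCost_mono w this).trans ((additiveCost_union_le w _ _).trans ?_)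
    rw [walkCost_cons, additiveCost_coe_finset, Finset.sum_singleton]
    push_cast
    refine add_le_add (le_of_eq ?_) ih
    rw [← edgeCost_coe w]

theorem reachable_of_walkEdges_subset {a b : V} (p : G.Walk a b) {F : Set G.edgeSet}
    (h : walkEdges p ⊆ F) : (SimpleGraph.fromEdgeSet (Subtype.val '' F)).Reachable a b := by
  induction p with
  | nil => exact SimpleGraph.Reachable.refl _
  | @cons a b d hab p ih =>
    have h1 : (SimpleGraph.fromEdgeSet (Subtype.val '' F)).Adj a b := by
      rw [SimpleGraph.fromEdgeSet_adj]
      refine ⟨⟨⟨s(a, b), hab⟩, h ?_, rfl⟩, hab.ne⟩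
      simp [walkEdges]
    refine h1.reachable.trans (ih fun e he => h ?_)
    simp only [walkEdges, SimpleGraph.Walk.edges_cons, List.mem_cons]
    exact Or.inr he

/-- A closed walk at `r` and a set of edges of `F` between its vertices that pays for one half of
it. -/
def IsPaidTour (r : V) (F : Set G.edgeSet) (t : G.Walk r r) (U : Finset G.edgeSet) : Prop :=
  (U : Set G.edgeSet) ⊆ F ∧ (∀ e ∈ U, ∀ x ∈ (e : Sym2 V), x ∈ t.support) ∧
    walkCost w t ≤ 2 * ∑ e ∈ U, w e

/-- The tour grows by a detour along an edge and back. This replaces doubling a spanning tree, and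
needs neither acyclicity nor finiteness of `F`. -/
theorem IsPaidTour.exists_adj {r : V} {F : Set G.edgeSet} {t : G.Walk r r} {U : Finset G.edgeSet}
    (h : IsPaidTour w r F t U) {a b : V} (ha : a ∈ t.support)
    (hab : (SimpleGraph.fromEdgeSet (Subtype.val '' F)).Adj a b) :
    ∃ t' U', IsPaidTour w r F t' U' ∧ t.support ⊆ t'.support ∧ b ∈ t'.support := by
  by_cases hb : b ∈ t.support
  · exact ⟨t, U, h, fun _ hx => hx, hb⟩
  rw [SimpleGraph.fromEdgeSet_adj] at hab
  obtain ⟨⟨e, heF, he⟩, -⟩ := hab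
  have hadj : G.Adj a b := by
    rw [← SimpleGraph.mem_edgeSet, ← he]
    exact e.2
  let d : G.Walk a a := SimpleGraph.Walk.cons hadj (SimpleGraph.Walk.cons hadj.symm .nil)
  let t' : G.Walk r r := (t.takeUntil a ha).append (d.append (t.dropUntil a ha))
  have hsub : t.support ⊆ t'.support := by
    intro x hx
    rw [← t.take_spec ha, SimpleGraph.Walk.mem_support_append_iff] at hx
    simp only [t', SimpleGraph.Walk.mem_support_append_iff]
    tauto
  have hbt : b ∈ t'.support := by
    simp [t', d, SimpleGraph.Walk.mem_support_append_iff]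
  -- The new edge is not yet charged: charged edges have both ends on the tour, and `b` is not on
  -- it.
  have heU : e ∉ U := fun heU => hb (h.2.1 e heU b (by rw [he]; simp))
  refine ⟨t', insert e U, ⟨?_, ?_, ?_⟩, hsub, hbt⟩
  · rw [Finset.coe_insert]
    exact Set.insert_subset heF h.1
  · intro e' he' x hx
    rcases Finset.mem_insert.1 he' with rfl | he'
    · rw [he, Sym2.mem_iff] at hx
      rcases hx with rfl | rfl
      · exact hsub ha
      · exact hbt
    · exact hsub (h.2.1 e' he' x hx)
  · have h1 : walkCost w t' = walkCost w t + 2 * w e := by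
      conv_rhs => rw [← t.take_spec ha]
      have hd : walkCost w d = 2 * w e := by
        simp only [d, walkCost_cons, walkCost_nil]
        rw [Sym2.eq_swap (a := b), ← he, edgeCost_coe]
        ring
      simp only [t', walkCost_append, hd]
      ring
    rw [h1, Finset.sum_insert heU, mul_add, add_comm]
    exact add_le_add le_rfl h.2.2

theorem IsPaidTour.exists_walk {r : V} {F : Set G.edgeSet} {a b : V}
    (q : (SimpleGraph.fromEdgeSet (Subtype.val '' F)).Walk a b) {t : G.Walk r r}
    {U : Finset G.edgeSet} (h : IsPaidTour w r F t U) (ha : a ∈ t.support) :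
    ∃ t' U', IsPaidTour w r F t' U' ∧ t.support ⊆ t'.support ∧ b ∈ t'.support := by
  induction q generalizing t U with
  | nil => exact ⟨t, U, h, fun _ hx => hx, ha⟩
  | cons hab q ih =>
    obtain ⟨t₁, U₁, h₁, hs₁, hb₁⟩ := h.exists_adj w ha hab
    obtain ⟨t₂, U₂, h₂, hs₂, hb₂⟩ := ih h₁ hb₁
    exact ⟨t₂, U₂, h₂, fun _ hx => hs₂ (hs₁ hx), hb₂⟩

theorem exists_isPaidTour (r : V) (F : Set G.edgeSet) (X : Finset V)
    (hX : ∀ x ∈ X, (SimpleGraph.fromEdgeSet (Subtype.val '' F)).Reachable r x) :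
    ∃ t U, IsPaidTour w r F t U ∧ ∀ x ∈ X, x ∈ t.support := by
  induction X using Finset.induction_on with
  | empty =>
    exact ⟨.nil, ∅, ⟨by simp, by simp, by simp [walkCost_nil]⟩, by simp⟩
  | insert a X _ ih =>
    obtain ⟨t, U, h, hs⟩ := ih fun x hx => hX x (Finset.mem_insert_of_mem hx)
    obtain ⟨q⟩ := hX a (Finset.mem_insert_self _ _)
    obtain ⟨t', U', h', hs', ha'⟩ := h.exists_walk w q t.start_mem_support
    refine ⟨t', U', h', fun x hx => ?_⟩
    rcases Finset.mem_insert.1 hx with rfl | hx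
    · exact ha'
    · exact hs' (hs x hx)

/-- The sequence `vert 0, …, vert N` is a closed walk at `r` that visits each `x ∈ X` at position
`pos x`. -/
structure IsTour (G : SimpleGraph V) (r : V) (X : Finset V) (N : ℕ) (vert : ℕ → V)
    (pos : V → ℕ) : Prop where
  vert_zero : vert 0 = r
  vert_last : vert N = r
  adj : ∀ k < N, G.Adj (vert k) (vert (k + 1))
  pos_le : ∀ x ∈ X, pos x ≤ N
  vert_pos : ∀ x ∈ X, vert (pos x) = x

/-- The lengths of the gaps of a tour. -/
def gapLength (vert : ℕ → V) (k : ℕ) : ℝ≥0 := edgeCost w s(vert k, vert (k + 1))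

theorem walkCost_eq_sum {a b : V} (p : G.Walk a b) :
    walkCost w p = ∑ k ∈ Finset.range p.length, gapLength w p.getVert k := by
  induction p with
  | nil => simp [walkCost_nil]
  | cons h p ih =>
    rw [walkCost_cons, SimpleGraph.Walk.length_cons, Finset.sum_range_succ', ih, add_comm]
    simp [gapLength]

theorem exists_isTour (r : V) (X : Finset V) (hX : (steinerTree G r w).opt X ≠ ∞) {ε : ℝ}
    (hε : 0 < ε) : ∃ N vert pos, IsTour G r X N vert pos ∧
      ((∑ k ∈ Finset.range N, gapLength w vert k : ℝ≥0) : ℝ≥0∞) ≤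
        2 * ((steinerTree G r w).opt X + ENNReal.ofReal ε) := by
  have hlt : (steinerTree G r w).opt X < (steinerTree G r w).opt X + ENNReal.ofReal ε :=
    ENNReal.lt_add_right hX (by simpa using hε)
  conv_lhs at hlt => rw [CoverageProblem.opt]
  obtain ⟨F, hF⟩ := iInf_lt_iff.1 hlt
  obtain ⟨hFf, hF⟩ := iInf_lt_iff.1 hF
  obtain ⟨t, U, h, hs⟩ := exists_isPaidTour w r F X fun x hx => hFf x hx
  have : ∀ x, ∃ k, x ∈ X → t.getVert k = x ∧ k ≤ t.length := by
    intro x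
    by_cases hx : x ∈ X
    · obtain ⟨k, hk⟩ := SimpleGraph.Walk.mem_support_iff_exists_getVert.1 (hs x hx)
      exact ⟨k, fun _ => hk⟩
    · exact ⟨0, fun h => absurd h hx⟩
  choose pos hpos using this
  refine ⟨t.length, t.getVert, pos, ⟨by simp, by simp, fun k hk => t.adj_getVert_succ hk,
    fun x hx => (hpos x hx).2, fun x hx => (hpos x hx).1⟩, ?_⟩
  rw [← walkCost_eq_sum]
  calc (walkCost w t : ℝ≥0∞) ≤ ((2 * ∑ e ∈ U, w e : ℝ≥0) : ℝ≥0∞) := ENNReal.coe_le_coe.2 h.2.2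
    _ = 2 * additiveCost w U := by
        rw [additiveCost_coe_finset]
        push_cast
        rfl
    _ ≤ 2 * (steinerTree G r w).cost F := mul_le_mul_right (additiveCost_mono w h.1) _
    _ ≤ _ := mul_le_mul_right hF.le _

theorem IsTour.exists_walk_le {r : V} {X : Finset V} {N : ℕ} {vert : ℕ → V} {pos : V → ℕ}
    (h : IsTour G r X N vert pos) {a b : ℕ} (hab : a ≤ b) (hb : b ≤ N) :
    ∃ p : G.Walk (vert a) (vert b),
      walkCost w p = ∑ k ∈ Finset.Ico a b, gapLength w vert k := by
  induction b, hab using Nat.le_induction with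
  | base => exact ⟨.nil, by simp [walkCost_nil]⟩
  | succ b hab ih =>
    obtain ⟨p, hp⟩ := ih (by omega)
    refine ⟨p.append (SimpleGraph.Walk.cons (h.adj b (by omega)) .nil), ?_⟩
    rw [walkCost_append, hp, walkCost_cons, walkCost_nil, add_zero,
      Finset.sum_Ico_succ_top hab]
    rfl

theorem IsTour.exists_walk {r : V} {X : Finset V} {N : ℕ} {vert : ℕ → V} {pos : V → ℕ}
    (h : IsTour G r X N vert pos) {p q : ℕ} (hp : p ≤ N) (hq : q ≤ N) :
    ∃ W : G.Walk (vert q) (vert p), (walkCost w W : ℝ) = lineDist (gapLength w vert) p q := by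
  rcases le_total p q with hpq | hpq
  · obtain ⟨W, hW⟩ := h.exists_walk_le w hpq hq
    refine ⟨W.reverse, ?_⟩
    rw [walkCost_reverse, hW, lineDist, min_eq_left hpq, max_eq_right hpq]
    push_cast
    rfl
  · obtain ⟨W, hW⟩ := h.exists_walk_le w hpq hp
    refine ⟨W, ?_⟩
    rw [hW, lineDist, min_eq_right hpq, max_eq_left hpq]
    push_cast
    rfl

end Tour

/-! ## Steiner Tree -/

section SteinerTree

open scoped Classical

variable {V : Type*} {G : SimpleGraph V} (w : G.edgeSet → ℝ≥0) (r : V)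

/-- `B` consists of the edges of an almost shortest walk from `r` or a point of `A` to `x`. -/
def IsNearestConnection (δ : ℝ) (A : Finset V) (x : V) (B : Set G.edgeSet) : Prop :=
  ∃ a ∈ insert r A, ∃ p : G.Walk a x, B = walkEdges p ∧
    ∀ b ∈ insert r A, ∀ q : G.Walk b x, (walkCost w p : ℝ) ≤ walkCost w q + δ

/-- The edges of an almost shortest walk from `r` or a point of `A` to `x`. -/
def nearestConnection (δ : ℝ) (A : Finset V) (x : V) : Set G.edgeSet :=
  if h : ∃ B, IsNearestConnection w r δ A x B then h.choose else ∅

theorem isNearestConnection_nearestConnection {δ : ℝ} (hδ : 0 < δ) (A : Finset V) {x : V}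
    (hx : G.Reachable r x) :
    IsNearestConnection w r δ A x (nearestConnection w r δ A x) := by
  have h : ∃ B, IsNearestConnection w r δ A x B := by
    let s : Set ℝ := {t | ∃ b ∈ insert r A, ∃ q : G.Walk b x, (walkCost w q : ℝ) = t}
    obtain ⟨q₀⟩ := hx
    have hs : s.Nonempty := ⟨_, r, Finset.mem_insert_self _ _, q₀, rfl⟩
    have hb : BddBelow s := ⟨0, by rintro _ ⟨b, -, q, rfl⟩; exact NNReal.coe_nonneg _⟩
    obtain ⟨_, ⟨a, ha, p, rfl⟩, hp⟩ := Real.lt_sInf_add_pos hs hδ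
    refine ⟨walkEdges p, a, ha, p, rfl, fun b hb' q => hp.le.trans ?_⟩
    gcongr
    exact csInf_le hb ⟨b, hb', q, rfl⟩
  rw [nearestConnection, dif_pos h]
  exact h.choose_spec

/-- The solution of the online algorithm for Steiner Tree that starts with the edges `B` serving
the demands `S`, after the arrivals `l`, last arrival first. -/
def steinerSolution (δ : ℝ) (B : Set G.edgeSet) (S : Finset V) : List V → Set G.edgeSet
  | [] => B
  | x :: l => steinerSolution δ B S l ∪ nearestConnection w r δ (S ∪ l.toFinset) x

theorem steinerSolution_feasible {δ : ℝ} (hδ : 0 < δ) {B : Set G.edgeSet} {S : Finset V}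
    (hB : B ∈ (steinerTree G r w).feasible S) (l : List V) (hl : ∀ x ∈ l, G.Reachable r x) :
    steinerSolution w r δ B S l ∈ (steinerTree G r w).feasible (S ∪ l.toFinset : Finset V) := by
  induction l with
  | nil => simpa [steinerSolution] using hB
  | cons x l ih =>
    have ih := ih fun y hy => hl y (List.mem_cons_of_mem _ hy)
    have hmono := SimpleGraph.fromEdgeSet_mono (Set.image_mono (f := Subtype.val)
      (Set.subset_union_left (s := steinerSolution w r δ B S l)
        (t := nearestConnection w r δ (S ∪ l.toFinset) x)))
    have hr : ∀ y ∈ insert r (S ∪ l.toFinset), (SimpleGraph.fromEdgeSet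
        (Subtype.val '' steinerSolution w r δ B S (x :: l))).Reachable r y := by
      intro y hy
      rcases Finset.mem_insert.1 hy with rfl | hy
      · exact SimpleGraph.Reachable.refl _
      · exact (ih y hy).mono hmono
    intro y hy
    rw [List.toFinset_cons, Finset.union_insert, Finset.mem_coe, Finset.mem_insert] at hy
    rcases hy with rfl | hy
    · obtain ⟨a, ha, p, hp, -⟩ := isNearestConnection_nearestConnection w r hδ (S ∪ l.toFinset)
        (hl y (by simp))
      refine (hr a ha).trans (reachable_of_walkEdges_subset p ?_)
      rw [← hp]
      exact Set.subset_union_right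
    · exact hr y (Finset.mem_insert_of_mem hy)

variable {w r}

/-- The positions of the root and of the points of `A` on a tour. -/
def markedPositions (N : ℕ) (pos : V → ℕ) (A : Finset V) : Finset ℕ :=
  insert 0 (insert N (A.image pos))

theorem markedPositions_insert (N : ℕ) (pos : V → ℕ) (A : Finset V) (x : V) :
    markedPositions N pos (insert x A) = insert (pos x) (markedPositions N pos A) := by
  simp only [markedPositions, Finset.image_insert]
  rw [Finset.insert_comm N, Finset.insert_comm 0]

/-- A stretch of the tour from a marked neighbour is a candidate walk. Positions 0 and `N` are
marked because both are the root. -/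
theorem IsTour.nearestConnection_cost_le {X : Finset V} {N : ℕ} {vert : ℕ → V} {pos : V → ℕ}
    (h : IsTour G r X N vert pos) {δ : ℝ} (hδ : 0 < δ) {A : Finset V} (hA : A ⊆ X) {x : V}
    (hxX : x ∈ X) (hx : G.Reachable r x) :
    additiveCost w (nearestConnection w r δ A x) ≤
      ENNReal.ofReal (∑ f ∈ Finset.range N, gapLength w vert f *
        (gapPotential (markedPositions N pos A) (X.image pos) f -
          gapPotential (markedPositions N pos (insert x A)) (X.image pos) f) + δ) := by
  obtain ⟨a, ha, p, hp, hmin⟩ := isNearestConnection_nearestConnection w r hδ A hx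
  obtain ⟨q, hq, hle⟩ := exists_lineDist_le (gapLength w vert) (Q := markedPositions N pos A)
    (R := X.image pos) (N := N) (p := pos x) (by simp [markedPositions]) (by simp [markedPositions])
    (h.pos_le x hxX) (Finset.mem_image_of_mem pos hxX)
  have hq' : q ≤ N ∧ vert q ∈ insert r A := by
    simp only [markedPositions, Finset.mem_insert, Finset.mem_image] at hq
    rcases hq with rfl | rfl | ⟨y, hy, rfl⟩
    · exact ⟨Nat.zero_le _, by rw [h.vert_zero]; exact Finset.mem_insert_self _ _⟩
    · exact ⟨le_rfl, by rw [h.vert_last]; exact Finset.mem_insert_self _ _⟩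
    · exact ⟨h.pos_le y (hA hy), by rw [h.vert_pos y (hA hy)]; exact Finset.mem_insert_of_mem hy⟩
  obtain ⟨W, hW⟩ := h.exists_walk w (h.pos_le x hxX) hq'.1
  have hWx := hmin _ hq'.2 (W.copy rfl (h.vert_pos x hxX))
  have hcopy : walkCost w (W.copy rfl (h.vert_pos x hxX)) = walkCost w W := by
    simp [walkCost]
  rw [hcopy, hW] at hWx
  rw [hp, markedPositions_insert]
  refine (additiveCost_walkEdges_le w p).trans ?_
  rw [← ENNReal.ofReal_coe_nnreal]
  exact ENNReal.ofReal_le_ofReal (by linarith)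

theorem IsTour.steinerSolution_cost_le {X : Finset V} {N : ℕ} {vert : ℕ → V} {pos : V → ℕ}
    (h : IsTour G r X N vert pos) {δ : ℝ} (hδ : 0 < δ) (B : Set G.edgeSet) (S : Finset V)
    (l : List V) (hX : S ∪ l.toFinset ⊆ X) (hl : ∀ x ∈ l, G.Reachable r x) :
    additiveCost w (steinerSolution w r δ B S l) ≤ additiveCost w B +
      ENNReal.ofReal (∑ f ∈ Finset.range N, gapLength w vert f *
        (gapPotential (markedPositions N pos S) (X.image pos) f -
          gapPotential (markedPositions N pos (S ∪ l.toFinset)) (X.image pos) f) +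
        l.length * δ) := by
  induction l with
  | nil => simp [steinerSolution]
  | cons x l ih =>
    have hu : S ∪ (x :: l).toFinset = insert x (S ∪ l.toFinset) := by
      rw [List.toFinset_cons, Finset.union_insert]
    rw [hu] at hX ⊢
    have hsub := (Finset.subset_insert x (S ∪ l.toFinset)).trans hX
    have h1 := ih hsub fun y hy => hl y (List.mem_cons_of_mem _ hy)
    have h2 := h.nearestConnection_cost_le (w := w) hδ hsub (hX (Finset.mem_insert_self _ _))
      (hl x (by simp))
    have hanti : ∀ {A A' : Finset V}, A ⊆ A' → 0 ≤ ∑ f ∈ Finset.range N, gapLength w vert f *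
        (gapPotential (markedPositions N pos A) (X.image pos) f -
          gapPotential (markedPositions N pos A') (X.image pos) f) := by
      intro A A' hAA'
      refine Finset.sum_nonneg fun f _ => mul_nonneg (NNReal.coe_nonneg _)
        (sub_nonneg.2 (gapPotential_anti ?_ _ _))
      exact Finset.insert_subset_insert _ (Finset.insert_subset_insert _
        (Finset.image_subset_image hAA'))
    refine (additiveCost_union_le w _ _).trans ((add_le_add h1 h2).trans (le_of_eq ?_))
    rw [add_assoc, ← ENNReal.ofReal_add (add_nonneg (hanti Finset.subset_union_left)
      (by positivity)) (add_nonneg (hanti (Finset.subset_insert _ _)) hδ.le)]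
    congr 2
    rw [add_add_add_comm, ← Finset.sum_add_distrib]
    congr 1
    · refine Finset.sum_congr rfl fun f _ => ?_
      ring
    · simp only [List.length_cons, Nat.cast_succ]
      ring

/-- The total length of the gaps that are visible from the position of `x`. -/
def visibleLength (ℓ : ℕ → ℝ≥0) (N : ℕ) (pos : V → ℕ) (Q : Finset ℕ) (x : V) : ℝ≥0 :=
  ∑ f ∈ Finset.range N, if Visible Q (pos x) f then ℓ f else 0

/-- Double counting of pairs of a gap and a point visible from it. Forgetting the marks of the root
only increases visibility, and leaves only the sample positions to be tracked under the exchange. -/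
theorem sum_visibleCount_le (ℓ : ℕ → ℝ≥0) (N : ℕ) (pos : V → ℕ) (S X : Finset V) :
    ∑ f ∈ Finset.range N, ℓ f * (visibleCount (markedPositions N pos S) (X.image pos) f : ℝ≥0) ≤
      ∑ x ∈ X \ S, visibleLength ℓ N pos (S.image pos) x := by
  simp only [visibleLength]
  rw [Finset.sum_comm]
  refine Finset.sum_le_sum fun f _ => ?_
  rw [← Finset.sum_filter, Finset.sum_const, nsmul_eq_mul, mul_comm]
  refine mul_le_mul_left ?_ _
  norm_cast
  have hsub : S.image pos ⊆ markedPositions N pos S :=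
    (Finset.subset_insert _ _).trans (Finset.subset_insert _ _)
  refine le_trans (Finset.card_le_card ?_) (Finset.card_image_le (f := pos))
  intro p hp
  obtain ⟨hp, hv⟩ := Finset.mem_filter.1 hp
  obtain ⟨x, hx, rfl⟩ := Finset.mem_image.1 hp
  refine Finset.mem_image_of_mem pos (Finset.mem_filter.2 ⟨Finset.mem_sdiff.2 ⟨hx, ?_⟩,
    hv.anti hsub⟩)
  exact fun hxS => not_visible_of_mem (hsub (Finset.mem_image_of_mem pos hxS)) f hv

/-- The receiving side of the exchange: with its own mark removed, a sample point sees only the gaps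
up to the next sample points, so each gap is seen at most twice. -/
theorem sum_visibleLength_erase_le (ℓ : ℕ → ℝ≥0) (N : ℕ) {pos : V → ℕ} {S : Finset V}
    (hpos : Set.InjOn pos S) :
    ∑ x ∈ S, visibleLength ℓ N pos ((S.image pos).erase (pos x)) x ≤
      2 * ∑ f ∈ Finset.range N, ℓ f := by
  simp only [visibleLength]
  rw [Finset.sum_comm, Finset.mul_sum]
  refine Finset.sum_le_sum fun f _ => ?_
  rw [← Finset.sum_filter, Finset.sum_const, nsmul_eq_mul]
  refine mul_le_mul_left ?_ _
  norm_cast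
  refine le_trans ?_ (card_visible_erase_le_two (S.image pos) f)
  rw [← Finset.card_image_of_injOn (hpos.mono (Finset.coe_subset.2 (Finset.filter_subset _ _)))]
  refine Finset.card_le_card fun q hq => ?_
  obtain ⟨x, hx, rfl⟩ := Finset.mem_image.1 hq
  obtain ⟨hx, hv⟩ := Finset.mem_filter.1 hx
  exact Finset.mem_filter.2 ⟨Finset.mem_image_of_mem pos hx, hv⟩

theorem IsTour.steinerSolution_cost_le_of_visible {X : Finset V} {N : ℕ} {vert : ℕ → V}
    {pos : V → ℕ} (h : IsTour G r X N vert pos) {δ : ℝ} (hδ : 0 < δ) (B : Set G.edgeSet)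
    (S : Finset V) (l : List V) (hX : S ∪ l.toFinset ⊆ X) (hl : ∀ x ∈ l, G.Reachable r x)
    {K : ℝ} (hK : 0 ≤ K) :
    additiveCost w (steinerSolution w r δ B S l) ≤ additiveCost w B +
      ENNReal.ofReal (2 * Real.log (1 + K) * (∑ f ∈ Finset.range N, gapLength w vert f : ℝ≥0) +
        2 / (1 + K) *
          (∑ x ∈ X \ S, visibleLength (gapLength w vert) N pos (S.image pos) x : ℝ≥0) +
        l.length * δ) := by
  refine (h.steinerSolution_cost_le (w := w) hδ B S l hX hl).trans ?_
  refine add_le_add le_rfl (ENNReal.ofReal_le_ofReal ?_)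
  refine add_le_add ?_ le_rfl
  have h1 := NNReal.coe_le_coe.2 (sum_visibleCount_le (gapLength w vert) N pos S X)
  have h2 : (0 : ℝ) ≤ 2 / (1 + K) := by positivity
  refine le_trans ?_ (add_le_add le_rfl (mul_le_mul_of_nonneg_left h1 h2))
  push_cast
  rw [Finset.mul_sum, Finset.mul_sum, ← Finset.sum_add_distrib]
  refine Finset.sum_le_sum fun f _ => ?_
  have h3 := gapPotential_nonneg (markedPositions N pos (S ∪ l.toFinset)) (X.image pos) f
  have h4 := gapPotential_le hK (markedPositions N pos S) (X.image pos) f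
  calc _ ≤ (gapLength w vert f : ℝ) * (2 * (Real.log (1 + K) +
        visibleCount (markedPositions N pos S) (X.image pos) f / (1 + K))) := by
        gcongr
        linarith
    _ = _ := by ring

theorem log_one_add_two_mul_exp_le {x : ℝ} (hx : 0 ≤ x) :
    Real.log (1 + 2 * Real.exp x) ≤ 2 + x := by
  rw [Real.log_le_iff_le_exp (by positivity), Real.exp_add]
  have h1 := Real.add_one_le_exp (2 : ℝ)
  have h2 := Real.one_le_exp hx
  nlinarith

theorem visibleLength_anti (ℓ : ℕ → ℝ≥0) (N : ℕ) (pos : V → ℕ) {Q Q' : Finset ℕ} (h : Q ⊆ Q')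
    (x : V) : visibleLength ℓ N pos Q' x ≤ visibleLength ℓ N pos Q x := by
  refine Finset.sum_le_sum fun f _ => ?_
  split_ifs with h1 h2 h2
  · exact le_rfl
  · exact absurd (h1.anti h) h2
  · exact zero_le
  · exact le_rfl

variable (w r)

theorem exists_feasible_cost_le {S : Set V} (hS : (steinerTree G r w).opt S ≠ ∞) {ε : ℝ}
    (hε : 0 < ε) : ∃ B ∈ (steinerTree G r w).feasible S,
      additiveCost w B ≤ (steinerTree G r w).opt S + ENNReal.ofReal ε := by
  have hlt : (steinerTree G r w).opt S < (steinerTree G r w).opt S + ENNReal.ofReal ε :=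
    ENNReal.lt_add_right hS (by simpa using hε)
  conv_lhs at hlt => rw [CoverageProblem.opt]
  obtain ⟨F, hF⟩ := iInf_lt_iff.1 hlt
  obtain ⟨hFf, hF⟩ := iInf_lt_iff.1 hF
  exact ⟨F, hFf, hF.le⟩

/-- Steiner Tree has `O(Δ)`-competitive algorithms up to an arbitrarily small error. -/
theorem steinerTree_approx {n : ℕ} (hn : n ≠ 0) {Ω : Fin n → Set V}
    {D : PMF ((i : Fin n) → Ω i)} {Δ : ℝ≥0} (hD : IsMRFDistribution D Δ)
    (hopt : ∀ u : (i : Fin n) → Ω i, (steinerTree G r w).opt (demandPoints u) ≠ ∞)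
    (hr : ∀ i, ∀ v ∈ Ω i, G.Reachable r v) {ε : ℝ} (hε : 0 < ε) :
    ∃ T : ((i : Fin n) → Ω i) → List V → Set G.edgeSet, (∀ s x l, T s l ⊆ T s (x :: l)) ∧
      (∀ s l, (∀ x ∈ l, ∃ i, x ∈ Ω i) → T s l ∈ (steinerTree G r w).feasible {x | x ∈ l}) ∧
      ∑' x : ((i : Fin n) → Ω i) × ((i : Fin n) → Ω i), D x.1 * D x.2 *
        (steinerTree G r w).cost (T x.1 (List.ofFn fun i => (x.2 i : V)).reverse) ≤
          (128 * (1 + Δ) : ℝ≥0) * ((steinerTree G r w).expectedOpt D + ENNReal.ofReal ε) := by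
  have hn0 : (0 : ℝ) < n := by exact_mod_cast Nat.pos_of_ne_zero hn
  set δ : ℝ := ε / n with hδdef
  have hδ : 0 < δ := by positivity
  have hδε : n * δ = ε := by
    rw [hδdef]
    field_simp
  choose B hB hBc using fun s : (i : Fin n) → Ω i => exists_feasible_cost_le w r (hopt s) hε
  refine ⟨fun s l => steinerSolution w r δ (B s) (demandPoints s) l,
    fun s x l => Set.subset_union_left, ?_, ?_⟩
  · intro s l hl
    refine (steinerTree G r w).feasible_anti ?_ (steinerSolution_feasible w r hδ (hB s) l ?_)
    · intro x hx
      exact Finset.mem_union_right (demandPoints s) (List.mem_toFinset.2 hx)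
    · intro x hx
      obtain ⟨i, hi⟩ := hl x hx
      exact hr i x hi
  have htour : ∀ X : Finset V, ∃ N vert pos, (steinerTree G r w).opt X ≠ ∞ →
      IsTour G r X N vert pos ∧
        ((∑ k ∈ Finset.range N, gapLength w vert k : ℝ≥0) : ℝ≥0∞) ≤
          2 * ((steinerTree G r w).opt X + ENNReal.ofReal ε) := by
    intro X
    by_cases hX : (steinerTree G r w).opt X = ∞
    · exact ⟨0, fun _ => r, fun _ => 0, fun h => absurd hX h⟩
    · obtain ⟨N, vert, pos, h⟩ := exists_isTour w r X hX hε
      exact ⟨N, vert, pos, fun _ => h⟩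
  choose N vert pos htour using htour
  have hjoint : ∀ x : ((i : Fin n) → Ω i) × ((i : Fin n) → Ω i),
      (steinerTree G r w).opt (jointDemandPoints x) ≠ ∞ := by
    intro x
    rw [jointDemandPoints, Finset.coe_union]
    exact ne_top_of_le_ne_top (ENNReal.add_ne_top.2 ⟨hopt x.1, hopt x.2⟩)
      ((steinerTree G r w).opt_union_le _ _)
  set K : ℝ := Real.exp (4 * Δ) with hKdef
  have hK : 0 ≤ K := (Real.exp_pos _).le
  let vis : Finset V → Finset ℕ → V → ℝ≥0 := fun X Q p =>
    visibleLength (gapLength w (vert X)) (N X) (pos X) Q p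
  let φ : ((i : Fin n) → Ω i) × ((i : Fin n) → Ω i) → V → ℝ≥0∞ := fun x p =>
    vis (jointDemandPoints x) ((demandPoints x.1).image (pos (jointDemandPoints x))) p
  let ψ : ((i : Fin n) → Ω i) × ((i : Fin n) → Ω i) → V → ℝ≥0∞ := fun x p =>
    vis (jointDemandPoints x) (((demandPoints x.1).image (pos (jointDemandPoints x))).erase
      (pos (jointDemandPoints x) p)) p
  have hexch := tsum_exchange_le D (fun i x => hD.mul_le i x) φ ψ (by
    intro x i _
    simp only [φ, ψ, jointDemandPoints_exchangeCoord]
    refine ENNReal.coe_le_coe.2 (visibleLength_anti _ _ _ ?_ _)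
    -- After the exchange the sample consists of old sample points and possibly the new point, whose
    -- mark is erased in `ψ`.
    rw [← Finset.subset_insert_iff, ← Finset.image_insert]
    exact Finset.image_subset_image (demandPoints_exchangeCoord_subset i x))
  -- The 4 is 2 · 2: each gap is seen from at most two sample points, and the tour costs at most
  -- twice the near-optimal tree.
  refine tsum_cost_le D (B := ENNReal.ofReal (2 / (1 + 2 * K))) (K := ENNReal.ofReal K * 4)
    (Φ := fun x => ∑ p ∈ jointDemandPoints x \ demandPoints x.1, φ x p) ?_ ?_ ?_
  · intro x
    have hl : demandPoints x.1 ∪ (List.ofFn fun i => (x.2 i : V)).reverse.toFinset =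
        jointDemandPoints x := by
      ext p
      simp [jointDemandPoints, mem_demandPoints]
    obtain ⟨ht, htl⟩ := htour _ (hjoint x)
    have h := ht.steinerSolution_cost_le_of_visible (w := w) hδ (B x.1) (demandPoints x.1)
      (List.ofFn fun i => (x.2 i : V)).reverse hl.le (by
        intro y hy
        obtain ⟨i, rfl⟩ := List.mem_ofFn.1 (List.mem_reverse.1 hy)
        exact hr i _ (x.2 i).2) (K := 2 * K) (by positivity)
    rw [List.length_reverse, List.length_ofFn, hδε] at h
    refine h.trans ?_
    have hlog : Real.log (1 + 2 * K) ≤ 2 + 4 * Δ := log_one_add_two_mul_exp_le (by positivity)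
    have hlog0 : 0 ≤ Real.log (1 + 2 * K) := Real.log_nonneg (by linarith)
    rw [ENNReal.ofReal_add (by positivity) hε.le, ENNReal.ofReal_add (by positivity)
      (by positivity), ENNReal.ofReal_mul (p := 2 * Real.log (1 + 2 * K)) (by positivity),
      ENNReal.ofReal_mul (p := 2 / (1 + 2 * K)) (by positivity), ENNReal.ofReal_coe_nnreal,
      ENNReal.ofReal_coe_nnreal, ENNReal.ofNNReal_finsetSum (s := _ \ _),
      ← add_assoc, ← add_assoc]
    refine add_le_add (add_le_add (add_le_add ?_ ?_) le_rfl) le_rfl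
    · exact (hBc x.1).trans (le_mul_of_one_le_left zero_le (by norm_num))
    · refine (mul_le_mul_right htl _).trans ?_
      rw [← mul_assoc]
      refine mul_le_mul_left ?_ _
      have h18 : (18 + 64 * Δ : ℝ≥0∞) = ENNReal.ofReal (18 + 64 * Δ) := by
        rw [ENNReal.ofReal_add (by norm_num) (by positivity), ENNReal.ofReal_mul (by norm_num)]
        simp
      rw [h18, ← ENNReal.ofReal_ofNat, ← ENNReal.ofReal_mul (by positivity)]
      refine ENNReal.ofReal_le_ofReal ?_
      have : (0 : ℝ) ≤ Δ := NNReal.coe_nonneg _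
      linarith
  · rw [mul_assoc]
    refine hexch.trans (mul_le_mul_right ?_ _)
    rw [← ENNReal.tsum_mul_left]
    refine ENNReal.tsum_le_tsum fun x => ?_
    obtain ⟨ht, htl⟩ := htour _ (hjoint x)
    have hinj : Set.InjOn (pos (jointDemandPoints x)) (demandPoints x.1) := by
      intro a ha b hb hab
      have hsub : demandPoints x.1 ⊆ jointDemandPoints x := Finset.subset_union_left
      rw [← ht.vert_pos a (hsub ha), hab, ht.vert_pos b (hsub hb)]
    have h1 := ENNReal.coe_le_coe.2
      (sum_visibleLength_erase_le (gapLength w (vert (jointDemandPoints x)))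
        (N (jointDemandPoints x)) hinj)
    rw [ENNReal.ofNNReal_finsetSum] at h1
    calc _ ≤ D x.1 * D x.2 * (2 * (2 * ((steinerTree G r w).opt (jointDemandPoints x) +
          ENNReal.ofReal ε))) := by
          refine mul_le_mul_right (h1.trans ?_) _
          rw [ENNReal.coe_mul]
          exact mul_le_mul_right htl _
      _ = _ := by ring
  · rw [← ENNReal.ofReal_ofNat, ← ENNReal.ofReal_ofNat, ← ENNReal.ofReal_mul (by positivity),
      ← ENNReal.ofReal_mul (by positivity)]
    refine ENNReal.ofReal_le_ofReal ?_
    rw [div_mul_eq_mul_div, div_le_iff₀ (by positivity)]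
    linarith

end SteinerTree

theorem steinerTree_exists_isCompetitive {V : Type*} (G : SimpleGraph V) (r : V)
    (w : G.edgeSet → ℝ≥0) {n : ℕ} {Ω : Fin n → Set V} {D : PMF ((i : Fin n) → Ω i)} {Δ : ℝ≥0}
    (hD : IsMRFDistribution D Δ)
    (hopt : ∀ i, ∀ v ∈ Ω i, (steinerTree G r w).HasOptimalSolution {v}) :
    ∃ R : RandomizedOnlineAlgorithm V G.edgeSet,
      R.IsCompetitive (steinerTree G r w) D (2 * (128 * (1 + Δ))) := by
  refine exists_isCompetitive_of_approx (fun _ h => h.elim) (additiveCost_empty _) D hD.ne_zero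
    hopt (by positivity) fun hn htop _ hε => steinerTree_approx w r hn hD htop ?_ hε
  intro i v hv
  obtain ⟨F, hF, -⟩ := hopt i v hv
  refine (hF v rfl).mono ?_
  intro a b hab
  rw [SimpleGraph.fromEdgeSet_adj] at hab
  obtain ⟨⟨e, -, he⟩, -⟩ := hab
  rw [← SimpleGraph.mem_edgeSet, ← he]
  exact e.2

end

/-! ### The constant for both problems -/

theorem mainTheorem3 :
    ∃ C : ℝ≥0,
      (∀ (M : Type u) [PseudoMetricSpace M] (c : M → ℝ≥0)
        (n : ℕ) (Ω : Fin n → Set M) (D : PMF ((i : Fin n) → Ω i)) (Δ : ℝ≥0),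
        IsMRFDistribution D Δ →
        (∀ i, ∀ v ∈ Ω i, (facilityLocation M c).HasOptimalSolution {v}) →
        ∃ R : RandomizedOnlineAlgorithm M (M ⊕ M × M),
          R.IsCompetitive (facilityLocation M c) D (C * (1 + Δ))) ∧
      (∀ (V : Type u) (G : SimpleGraph V) (r : V) (w : G.edgeSet → ℝ≥0)
        (n : ℕ) (Ω : Fin n → Set V) (D : PMF ((i : Fin n) → Ω i)) (Δ : ℝ≥0),
        IsMRFDistribution D Δ →
        (∀ i, ∀ v ∈ Ω i, (steinerTree G r w).HasOptimalSolution {v}) →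
        ∃ R : RandomizedOnlineAlgorithm V G.edgeSet,
          R.IsCompetitive (steinerTree G r w) D (C * (1 + Δ))) := by
  -- 128 from the expected cost, doubled by absorbing the additive error.
  refine ⟨256, ?_, ?_⟩
  · intro M _ c n Ω D Δ hD hopt
    have h : (256 : ℝ≥0) * (1 + Δ) = 2 * (128 * (1 + Δ)) := by ring
    rw [h]
    exact facilityLocation_exists_isCompetitive c hD hopt
  · intro V G r w n Ω D Δ hD hopt
    have h : (256 : ℝ≥0) * (1 + Δ) = 2 * (128 * (1 + Δ)) := by ring
    rw [h]
    exact steinerTree_exists_isCompetitive G r w hD hopt
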